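/- Work in the two-sorted language of second-order arithmetic, with symbols $0,1,+,\times,<,\in$, equality of numbers, number quantifiers and set quantifiers. A structure consists of a number sort $\mathbb{N}$ (possibly nonstandard) and a set sort, over which the set quantifiers range. $\mathsf{RCA}_0$ consists of the axioms of discretely ordered commutative semirings with identity, the induction scheme for $\Sigma^0_1$ formulas, and the comprehension scheme for $\Delta^0_1$ formulas (number and set parameters are allowed in both); $\mathsf{ACA}_0$ is $\mathsf{RCA}_0$ together with comprehension for all arithmetical formulas. A graph $G=(V,E)$ is given by sets $V\subseteq\mathbb{N}$ and $E\subseteq[V]^2=\{(x,y): x,y\in V,\ x<y\}$, pairs being coded by $(x,y)\mapsto (x+y)^2+x$; for $x\in V$, $N(x)$ is the set of $y\in V$ with $(\min\{x,y\},\max\{x,y\})\in E$. A set of numbers is finite if it is bounded, and infinite otherwise. A graph is infinite if $V$ is infinite, and locally finite if $N(x)$ is finite for every $x\in V$. **Theorem.** The following are equivalent over $\mathsf{RCA}_0$; that is, in every model of $\mathsf{RCA}_0$, if one of them holds, then all of them hold. 1. $\mathsf{ACA}_0$. 2. The Rival–Sands theorem for graphs ($\mathsf{RSg}$): for every infinite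 graph $G=(V,E)$ there is an infinite set $H\subseteq V$ such that for every $x\in V$, either $H\cap N(x)$ is infinite or $|H\cap N(x)|\le 1$. 3. The Rival–Sands theorem for graphs, refined ($\mathsf{RSgr}$): for every infinite graph $G=(V,E)$ there is an infinite set $H\subseteq V$ such that for every $x\in V$, either $H\cap N(x)$ is infinite or $|H\cap N(x)|\le 1$, and moreover for every $x\in H$, either $H\cap N(x)$ is infinite or $H\cap N(x)=\emptyset$. 4. The statement of 2 restricted to infinite locally finite graphs. 5. The statement of 3 restricted to infinite locally finite graphs. -/

import Mathlib

namespace SOA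

/-! ## The two-sorted language of second-order arithmetic

Formulas are well scoped: a `Formula m k` has its free number variables among `#0, …, #(m-1)` and
its free set variables among `0, …, k-1`.  A quantifier on a formula of `Formula (m+1) k` (or
`Formula m (k+1)`) binds the *last* number (or set) variable, so that the variables of a sentence
are numbered in the order in which they are quantified, from the outside in. -/

/-- Number terms with number variables `#0, …, #(m-1)`. -/
inductive Term (m : ℕ) : Type
  | var (i : Fin m) : Term m
  | zero : Term m
  | one : Term m
  | add (t u : Term m) : Term m
  | mul (t u : Term m) : Term m

local prefix:max "#" => Term.var

/-- Formulas of second-order arithmetic with `m` free number variables and `k` free set variables.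
The atomic formulas are `t = u`, `t < u` and `t ∈ X`; there is no primitive equality of sets. -/
inductive Formula : ℕ → ℕ → Type
  | eq {m k : ℕ} (t u : Term m) : Formula m k
  | lt {m k : ℕ} (t u : Term m) : Formula m k
  | mem {m k : ℕ} (t : Term m) (X : Fin k) : Formula m k
  | not {m k : ℕ} (φ : Formula m k) : Formula m k
  | and {m k : ℕ} (φ ψ : Formula m k) : Formula m k
  | or {m k : ℕ} (φ ψ : Formula m k) : Formula m k
  | imp {m k : ℕ} (φ ψ : Formula m k) : Formula m k
  | all {m k : ℕ} (φ : Formula (m + 1) k) : Formula m k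
  | ex {m k : ℕ} (φ : Formula (m + 1) k) : Formula m k
  | allSet {m k : ℕ} (φ : Formula m (k + 1)) : Formula m k
  | exSet {m k : ℕ} (φ : Formula m (k + 1)) : Formula m k

/-- Sentences: formulas without free variables. -/
abbrev Sentence : Type := Formula 0 0

/-- Theories: sets of sentences. -/
abbrev Theory : Type := Set Sentence

local infix:60 " ≐ " => Formula.eq
local infix:60 " ≺ " => Formula.lt
local infix:60 " ∈' " => Formula.mem
local prefix:58 "∼ " => Formula.not
local infixr:55 " ⋏ " => Formula.and
local infixr:54 " ⋎ " => Formula.or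
local infixr:53 " ⟶' " => Formula.imp

/-! ### Substitution and universal closure -/

/-- Simultaneous substitution of terms for the number variables of a term. -/
def Term.subst {m m' : ℕ} (σ : Fin m → Term m') : Term m → Term m'
  | .var i => σ i
  | .zero => .zero
  | .one => .one
  | .add t u => .add (t.subst σ) (u.subst σ)
  | .mul t u => .mul (t.subst σ) (u.subst σ)

/-- The same term, with one more number variable available. -/
def Term.weaken {m : ℕ} (t : Term m) : Term (m + 1) := t.subst fun i => #i.castSucc

/-- Capture-avoiding simultaneous substitution of terms for the free number variables, and of set
variables for the free set variables, of a formula. -/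
def Formula.subst : {m k m' k' : ℕ} → (Fin m → Term m') → (Fin k → Fin k') →
    Formula m k → Formula m' k'
  | _, _, _, _, σ, _, .eq t u => .eq (t.subst σ) (u.subst σ)
  | _, _, _, _, σ, _, .lt t u => .lt (t.subst σ) (u.subst σ)
  | _, _, _, _, σ, ρ, .mem t X => .mem (t.subst σ) (ρ X)
  | _, _, _, _, σ, ρ, .not φ => .not (φ.subst σ ρ)
  | _, _, _, _, σ, ρ, .and φ ψ => .and (φ.subst σ ρ) (ψ.subst σ ρ)
  | _, _, _, _, σ, ρ, .or φ ψ => .or (φ.subst σ ρ) (ψ.subst σ ρ)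
  | _, _, _, _, σ, ρ, .imp φ ψ => .imp (φ.subst σ ρ) (ψ.subst σ ρ)
  | m, _, m', _, σ, ρ, .all φ =>
      .all (φ.subst (Fin.snoc (α := fun _ : Fin (m + 1) => Term (m' + 1))
        (fun i => (σ i).weaken) #(Fin.last m')) ρ)
  | m, _, m', _, σ, ρ, .ex φ =>
      .ex (φ.subst (Fin.snoc (α := fun _ : Fin (m + 1) => Term (m' + 1))
        (fun i => (σ i).weaken) #(Fin.last m')) ρ)
  | _, k, _, k', σ, ρ, .allSet φ =>
      .allSet (φ.subst σ (Fin.snoc (α := fun _ : Fin (k + 1) => Fin (k' + 1))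
        (fun i => (ρ i).castSucc) (Fin.last k')))
  | _, k, _, k', σ, ρ, .exSet φ =>
      .exSet (φ.subst σ (Fin.snoc (α := fun _ : Fin (k + 1) => Fin (k' + 1))
        (fun i => (ρ i).castSucc) (Fin.last k')))

namespace Formula

/-- For `φ(n)` with `n` the last number variable: the formula `φ(0)`. -/
def atZero {m k : ℕ} (φ : Formula (m + 1) k) : Formula m k :=
  φ.subst (Fin.snoc (α := fun _ : Fin (m + 1) => Term m) (fun i => #i) .zero) id

/-- For `φ(n)` with `n` the last number variable: the formula `φ(n + 1)`. -/
def atSucc {m k : ℕ} (φ : Formula (m + 1) k) : Formula (m + 1) k :=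
  φ.subst (Fin.snoc (α := fun _ : Fin (m + 1) => Term (m + 1)) (fun i => #i.castSucc)
    (.add #(Fin.last m) .one)) id

/-- The same formula, with one more set variable available (which is not free in it). -/
def weakenSet {m k : ℕ} (φ : Formula m k) : Formula m (k + 1) :=
  φ.subst (fun i => #i) Fin.castSucc

/-- The biconditional. -/
def iff {m k : ℕ} (φ ψ : Formula m k) : Formula m k := (φ ⟶' ψ) ⋏ (ψ ⟶' φ)

/-- Universal quantification over all free number variables. -/
def closeNum : {m k : ℕ} → Formula m k → Formula 0 k
  | 0, _, φ => φ
  | _ + 1, _, φ => closeNum (.all φ)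

/-- Universal quantification over all free set variables. -/
def closeSet : {k : ℕ} → Formula 0 k → Sentence
  | 0, φ => φ
  | _ + 1, φ => closeSet (.allSet φ)

/-- The universal closure of a formula. -/
def closure {m k : ℕ} (φ : Formula m k) : Sentence := φ.closeNum.closeSet

/-! ### Classes of formulas -/

/-- Bounded (`Σ⁰₀`) formulas: no set quantifiers, and number quantifiers only in the forms
`∀ n < t` and `∃ n < t` with `n` not in `t`.  Set variables may occur free. -/
inductive IsBounded : {m k : ℕ} → Formula m k → Prop
  | eq {m k : ℕ} (t u : Term m) : IsBounded (.eq t u : Formula m k)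
  | lt {m k : ℕ} (t u : Term m) : IsBounded (.lt t u : Formula m k)
  | mem {m k : ℕ} (t : Term m) (X : Fin k) : IsBounded (.mem t X)
  | not {m k : ℕ} {φ : Formula m k} : IsBounded φ → IsBounded (.not φ)
  | and {m k : ℕ} {φ ψ : Formula m k} : IsBounded φ → IsBounded ψ → IsBounded (.and φ ψ)
  | or {m k : ℕ} {φ ψ : Formula m k} : IsBounded φ → IsBounded ψ → IsBounded (.or φ ψ)
  | imp {m k : ℕ} {φ ψ : Formula m k} : IsBounded φ → IsBounded ψ → IsBounded (.imp φ ψ)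
  | ball {m k : ℕ} (t : Term m) {φ : Formula (m + 1) k} : IsBounded φ →
      IsBounded (.all (#(Fin.last m) ≺ t.weaken ⟶' φ))
  | bex {m k : ℕ} (t : Term m) {φ : Formula (m + 1) k} : IsBounded φ →
      IsBounded (.ex (#(Fin.last m) ≺ t.weaken ⋏ φ))

/-- `Σ⁰₁` formulas: `∃ n θ` with `θ` bounded. -/
def IsSigma1 {m k : ℕ} (φ : Formula m k) : Prop :=
  ∃ θ : Formula (m + 1) k, θ.IsBounded ∧ φ = .ex θ

/-- `Π⁰₁` formulas: `∀ n θ` with `θ` bounded. -/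
def IsPi1 {m k : ℕ} (φ : Formula m k) : Prop :=
  ∃ θ : Formula (m + 1) k, θ.IsBounded ∧ φ = .all θ

/-- Arithmetical formulas: no set quantifiers (set variables may occur free). -/
def IsArithmetical : {m k : ℕ} → Formula m k → Prop
  | _, _, .eq _ _ => True
  | _, _, .lt _ _ => True
  | _, _, .mem _ _ => True
  | _, _, .not φ => φ.IsArithmetical
  | _, _, .and φ ψ => φ.IsArithmetical ∧ ψ.IsArithmetical
  | _, _, .or φ ψ => φ.IsArithmetical ∧ ψ.IsArithmetical
  | _, _, .imp φ ψ => φ.IsArithmetical ∧ ψ.IsArithmetical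
  | _, _, .all φ => φ.IsArithmetical
  | _, _, .ex φ => φ.IsArithmetical
  | _, _, .allSet _ => False
  | _, _, .exSet _ => False

end Formula

/-! ## Semantics -/

/-- Structures for the language of second-order arithmetic: an arbitrary number sort and an
arbitrary set sort (the set quantifiers range over the latter, not over the full power set). -/
structure L2Structure.{u, v} where
  /-- the number sort -/
  Num : Type u
  /-- the set sort -/
  Sets : Type v
  zero : Num
  one : Num
  add : Num → Num → Num
  mul : Num → Num → Num
  lt : Num → Num → Prop
  mem : Num → Sets → Prop

/-- The value of a term. -/
def Term.eval (M : L2Structure) {m : ℕ} (e : Fin m → M.Num) : Term m → M.Num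
  | .var i => e i
  | .zero => M.zero
  | .one => M.one
  | .add t u => M.add (t.eval M e) (u.eval M e)
  | .mul t u => M.mul (t.eval M e) (u.eval M e)

/-- Tarski's truth definition. -/
def Formula.Realize (M : L2Structure) : {m k : ℕ} → Formula m k →
    (Fin m → M.Num) → (Fin k → M.Sets) → Prop
  | _, _, .eq t u, e, _ => t.eval M e = u.eval M e
  | _, _, .lt t u, e, _ => M.lt (t.eval M e) (u.eval M e)
  | _, _, .mem t X, e, s => M.mem (t.eval M e) (s X)
  | _, _, .not φ, e, s => ¬ φ.Realize M e s
  | _, _, .and φ ψ, e, s => φ.Realize M e s ∧ ψ.Realize M e s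
  | _, _, .or φ ψ, e, s => φ.Realize M e s ∨ ψ.Realize M e s
  | _, _, .imp φ ψ, e, s => φ.Realize M e s → ψ.Realize M e s
  | m, _, .all φ, e, s =>
      ∀ a : M.Num, φ.Realize M (Fin.snoc (α := fun _ : Fin (m + 1) => M.Num) e a) s
  | m, _, .ex φ, e, s =>
      ∃ a : M.Num, φ.Realize M (Fin.snoc (α := fun _ : Fin (m + 1) => M.Num) e a) s
  | _, k, .allSet φ, e, s =>
      ∀ A : M.Sets, φ.Realize M e (Fin.snoc (α := fun _ : Fin (k + 1) => M.Sets) s A)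
  | _, k, .exSet φ, e, s =>
      ∃ A : M.Sets, φ.Realize M e (Fin.snoc (α := fun _ : Fin (k + 1) => M.Sets) s A)

/-- Truth of a sentence in a structure. -/
def L2Structure.Satisfies (M : L2Structure) (φ : Sentence) : Prop :=
  φ.Realize M Fin.elim0 Fin.elim0

/-- `M` is a model of the theory `T`. -/
def L2Structure.IsModel (M : L2Structure) (T : Theory) : Prop :=
  ∀ φ ∈ T, M.Satisfies φ

/-! ## The axiom systems -/

open Formula

/-- `t ≤ u`, that is, `t < u` or `t = u`. -/
def leF {m k : ℕ} (t u : Term m) : Formula m k := t ≺ u ⋎ t ≐ u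

/-- The axioms of discretely ordered commutative semirings with identity. -/
def basicAxioms : Theory :=
  { closure (m := 3) (k := 0) (.add (.add #0 #1) #2 ≐ .add #0 (.add #1 #2)),
    closure (m := 2) (k := 0) (.add #0 #1 ≐ .add #1 #0),
    closure (m := 3) (k := 0) (.mul (.mul #0 #1) #2 ≐ .mul #0 (.mul #1 #2)),
    closure (m := 2) (k := 0) (.mul #0 #1 ≐ .mul #1 #0),
    closure (m := 3) (k := 0) (.mul #0 (.add #1 #2) ≐ .add (.mul #0 #1) (.mul #0 #2)),
    closure (m := 1) (k := 0) (.add #0 .zero ≐ #0),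
    closure (m := 1) (k := 0) (.mul #0 .zero ≐ .zero),
    closure (m := 1) (k := 0) (.mul #0 .one ≐ #0),
    -- `<` is a strict linear order
    closure (m := 3) (k := 0) (#0 ≺ #1 ⋏ #1 ≺ #2 ⟶' #0 ≺ #2),
    closure (m := 1) (k := 0) (∼ #0 ≺ #0),
    closure (m := 2) (k := 0) (#0 ≺ #1 ⋎ #0 ≐ #1 ⋎ #1 ≺ #0),
    -- compatibility of the order with the operations
    closure (m := 3) (k := 0) (#0 ≺ #1 ⟶' .add #0 #2 ≺ .add #1 #2),
    closure (m := 3) (k := 0) (.zero ≺ #2 ⋏ #0 ≺ #1 ⟶' .mul #0 #2 ≺ .mul #1 #2),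
    closure (m := 2) (k := 0) (#0 ≺ #1 ⟶' .ex (.add #0 #2 ≐ #1)),
    -- nonnegativity and discreteness
    closure (m := 0) (k := 0) (.zero ≺ .one),
    closure (m := 1) (k := 0) (leF .zero #0),
    closure (m := 1) (k := 0) (.zero ≺ #0 ⟶' leF .one #0) }

/-- The induction axiom for `φ(n)`, `n` being the last number variable. -/
def inductionAxiom {m k : ℕ} (φ : Formula (m + 1) k) : Sentence :=
  closure (φ.atZero ⋏ .all (φ ⟶' φ.atSucc) ⟶' .all φ)

/-- `∃ X ∀ n (n ∈ X ↔ φ(n))`, `n` being the last number variable and `X` a new set variable. -/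
def existsSetOf {m k : ℕ} (φ : Formula (m + 1) k) : Formula m k :=
  .exSet (.all (Formula.iff (#(Fin.last m) ∈' Fin.last k) φ.weakenSet))

/-- The `Σ⁰₁` induction scheme. -/
def sigma1Induction : Theory :=
  { χ | ∃ (m k : ℕ) (φ : Formula (m + 1) k), φ.IsSigma1 ∧ χ = inductionAxiom φ }

/-- The `Δ⁰₁` comprehension scheme. -/
def delta1Comprehension : Theory :=
  { χ | ∃ (m k : ℕ) (φ ψ : Formula (m + 1) k), φ.IsSigma1 ∧ ψ.IsPi1 ∧
      χ = closure (.all (Formula.iff φ ψ) ⟶' existsSetOf φ) }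

/-- The arithmetical comprehension scheme. -/
def arithmeticalComprehension : Theory :=
  { χ | ∃ (m k : ℕ) (φ : Formula (m + 1) k), φ.IsArithmetical ∧ χ = closure (existsSetOf φ) }

/-- The axiom system `RCA₀`. -/
def RCA0 : Theory := basicAxioms ∪ sigma1Induction ∪ delta1Comprehension

/-- The axiom system `ACA₀`. -/
def ACA0 : Theory := RCA0 ∪ arithmeticalComprehension

/-! ## The Rival–Sands theorem for graphs as sentences of second-order arithmetic -/

/-- The code `(t + u)² + t` of the ordered pair `(t, u)`. -/
def pairT {m : ℕ} (t u : Term m) : Term m := .add (.mul (.add t u) (.add t u)) t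

/-- `V` is infinite: `∀ b ∃ y (b < y ∧ y ∈ V)`. -/
def infiniteF {m k : ℕ} (V : Fin k) : Formula m k :=
  .all (.ex (#(Fin.last m).castSucc ≺ #(Fin.last (m + 1)) ⋏ #(Fin.last (m + 1)) ∈' V))

/-- `H ⊆ V`. -/
def subsetF {m k : ℕ} (H V : Fin k) : Formula m k :=
  .all (#(Fin.last m) ∈' H ⟶' #(Fin.last m) ∈' V)

/-- `(V, E)` is a (simple) graph: `E ⊆ [V]²`, that is, every element of `E` is the code of a pair
`(x, y)` with `x, y ∈ V` and `x < y`. -/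
def graphF {k : ℕ} (V E : Fin k) : Formula 0 k :=
  .all (#0 ∈' E ⟶' .ex (.ex (#1 ∈' V ⋏ #2 ∈' V ⋏ #1 ≺ #2 ⋏ #0 ≐ pairT #1 #2)))

/-- `y ∈ N(x)`: `y ∈ V` and the code of `(min {x, y}, max {x, y})` is in `E`. -/
def nbrF {m k : ℕ} (V E : Fin k) (x y : Fin m) : Formula m k :=
  #y ∈' V ⋏ ((#x ≺ #y ⋏ pairT #x #y ∈' E) ⋎ (#y ≺ #x ⋏ pairT #y #x ∈' E))

/-- `(V, E)` is locally finite: `∀ x ∈ V ∃ b ∀ y (y ∈ N(x) → y < b)`. -/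
def locallyFiniteF {k : ℕ} (V E : Fin k) : Formula 0 k :=
  .all (#0 ∈' V ⟶' .ex (.all (nbrF V E 0 2 ⟶' #2 ≺ #1)))

/-- `H ∩ N(x)` is infinite, where `x = #0`. -/
def infiniteNbrsF {k : ℕ} (V E H : Fin k) : Formula 1 k :=
  .all (.ex (#1 ≺ #2 ⋏ #2 ∈' H ⋏ nbrF V E 0 2))

/-- `|H ∩ N(x)| ≤ 1`, where `x = #0`. -/
def atMostOneNbrF {k : ℕ} (V E H : Fin k) : Formula 1 k :=
  .all (.all ((#1 ∈' H ⋏ nbrF V E 0 1) ⋏ (#2 ∈' H ⋏ nbrF V E 0 2) ⟶' #1 ≐ #2))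

/-- `H ∩ N(x) = ∅`, where `x = #0`. -/
def noNbrF {k : ℕ} (V E H : Fin k) : Formula 1 k :=
  .all (∼ (#1 ∈' H ⋏ nbrF V E 0 1))

/-- `H` is an infinite subset of `V` such that for every `x ∈ V`, either `H ∩ N(x)` is infinite or
`|H ∩ N(x)| ≤ 1`. -/
def solutionF {k : ℕ} (V E H : Fin k) : Formula 0 k :=
  infiniteF H ⋏ subsetF H V ⋏
    .all (#0 ∈' V ⟶' infiniteNbrsF V E H ⋎ atMostOneNbrF V E H)

/-- In addition, for every `x ∈ H`, either `H ∩ N(x)` is infinite or `H ∩ N(x) = ∅`. -/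
def refinedSolutionF {k : ℕ} (V E H : Fin k) : Formula 0 k :=
  solutionF V E H ⋏ .all (#0 ∈' H ⟶' infiniteNbrsF V E H ⋎ noNbrF V E H)

/-- The Rival–Sands theorem for graphs (set variables: `V = 0`, `E = 1`, `H = 2`). -/
def RSg : Sentence :=
  .allSet (.allSet (graphF 0 1 ⋏ infiniteF 0 ⟶' .exSet (solutionF 0 1 2)))

/-- The Rival–Sands theorem for graphs, refined. -/
def RSgr : Sentence :=
  .allSet (.allSet (graphF 0 1 ⋏ infiniteF 0 ⟶' .exSet (refinedSolutionF 0 1 2)))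

/-- The Rival–Sands theorem for locally finite graphs. -/
def RSgLF : Sentence :=
  .allSet (.allSet (graphF 0 1 ⋏ infiniteF 0 ⋏ locallyFiniteF 0 1 ⟶' .exSet (solutionF 0 1 2)))

/-- The Rival–Sands theorem for locally finite graphs, refined. -/
def RSgrLF : Sentence :=
  .allSet (.allSet (graphF 0 1 ⋏ infiniteF 0 ⋏ locallyFiniteF 0 1 ⟶'
    .exSet (refinedSolutionF 0 1 2)))

end SOA

namespace SOA

/-! ## Substitution lemmas -/

/-! Everything takes place inside a fixed model of `RCA0`, where `ACA0` amounts to the existence of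
projections of sets (`SigmaComp`, `isModel_ACA0_iff`).

Reversal (`sigmaComp_of_locallyFinite`). Given X, say that n appears at stage z if z is the least
number with `pair n z ∈ X`. Join y < z when some n < y appears at stage z. By strong collection this
graph is locally finite, so a solution H meets every neighbourhood at most once. If n < y < y' with
y, y' in H, then n cannot appear at a stage z > y', since z would be joined to both. Hence H bounds
the search for witnesses and the projection of X is `Δ⁰₁`.

Forward direction (`exists_refined`). Let F₀ be the set of vertices of finite degree. If F₀ is
bounded, a final segment of V avoids all neighbours of F₀ and is a solution. Otherwise let B consist
of the numbers with infinitely many neighbours in F₀. An increasing sequence in F₀ is built by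
arithmetical recursion (`exists_recursion`): a new term is adjacent to no earlier term, shares with
an earlier term no neighbour outside B, and each member of B is given a neighbour infinitely often.
The range is an independent set and solves the refined problem.

The base theory has no exponentiation at hand, so finite sets are coded by divisibility
(`exists_code`). These codes yield strong collection, through a least number argument, and the
computation histories for recursion. Syntax is hidden behind `BddDef`, definability by a bounded
formula with parameters. -/

theorem Term.eval_subst (M : L2Structure) {m m' : ℕ} (σ : Fin m → Term m') (e : Fin m' → M.Num)
    (t : Term m) : (t.subst σ).eval M e = t.eval M fun i => (σ i).eval M e := by
  induction t with
  | var i => rfl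
  | zero => rfl
  | one => rfl
  | add t u ht hu => simp only [Term.subst, Term.eval, ht, hu]
  | mul t u ht hu => simp only [Term.subst, Term.eval, ht, hu]

theorem Term.eval_weaken (M : L2Structure) {m : ℕ} (e : Fin m → M.Num) (a : M.Num) (t : Term m) :
    t.weaken.eval M (Fin.snoc (α := fun _ : Fin (m + 1) => M.Num) e a) = t.eval M e := by
  simp [Term.weaken, Term.eval_subst, Term.eval]

theorem Term.subst_subst {m m' m'' : ℕ} (σ : Fin m → Term m') (τ : Fin m' → Term m'')
    (t : Term m) : (t.subst σ).subst τ = t.subst fun i => (σ i).subst τ := by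
  induction t with
  | var i => rfl
  | zero => rfl
  | one => rfl
  | add t u ht hu => simp only [Term.subst, ht, hu]
  | mul t u ht hu => simp only [Term.subst, ht, hu]

theorem Term.eval_snoc_weaken (M : L2Structure) {m m' : ℕ} (σ : Fin m → Term m')
    (e : Fin m' → M.Num) (a : M.Num) :
    (fun i => (Fin.snoc (α := fun _ : Fin (m + 1) => Term (m' + 1)) (fun i => (σ i).weaken)
      (.var (Fin.last m')) i : Term (m' + 1)).eval M
        (Fin.snoc (α := fun _ : Fin (m' + 1) => M.Num) e a)) =
      Fin.snoc (α := fun _ : Fin (m + 1) => M.Num) (fun i => (σ i).eval M e) a := by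
  funext i
  refine Fin.lastCases ?_ (fun i => ?_) i
  · simp [Term.eval]
  · simp [Term.eval_weaken]

theorem snoc_comp_snoc {A : Type*} {k k' : ℕ} (ρ : Fin k → Fin k') (s : Fin k' → A) (a : A) :
    (fun i => Fin.snoc (α := fun _ : Fin (k' + 1) => A) s a
      (Fin.snoc (α := fun _ : Fin (k + 1) => Fin (k' + 1)) (fun i => (ρ i).castSucc)
        (Fin.last k') i)) = Fin.snoc (α := fun _ : Fin (k + 1) => A) (fun i => s (ρ i)) a := by
  funext i
  refine Fin.lastCases ?_ (fun i => ?_) i <;> simp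

theorem Formula.realize_subst (M : L2Structure) {m k : ℕ} (φ : Formula m k) :
    ∀ {m' k' : ℕ} (σ : Fin m → Term m') (ρ : Fin k → Fin k') (e : Fin m' → M.Num)
      (s : Fin k' → M.Sets), (φ.subst σ ρ).Realize M e s ↔
        φ.Realize M (fun i => (σ i).eval M e) (fun i => s (ρ i)) := by
  induction φ with
  | eq t u => intros; simp only [Formula.subst, Formula.Realize, Term.eval_subst]
  | lt t u => intros; simp only [Formula.subst, Formula.Realize, Term.eval_subst]
  | mem t X => intros; simp only [Formula.subst, Formula.Realize, Term.eval_subst]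
  | not φ ih => intros; simp only [Formula.subst, Formula.Realize, ih]
  | and φ ψ ih₁ ih₂ => intros; simp only [Formula.subst, Formula.Realize, ih₁, ih₂]
  | or φ ψ ih₁ ih₂ => intros; simp only [Formula.subst, Formula.Realize, ih₁, ih₂]
  | imp φ ψ ih₁ ih₂ => intros; simp only [Formula.subst, Formula.Realize, ih₁, ih₂]
  | all φ ih =>
    intros; simp only [Formula.subst, Formula.Realize, ih, Term.eval_snoc_weaken]
  | ex φ ih =>
    intros; simp only [Formula.subst, Formula.Realize, ih, Term.eval_snoc_weaken]
  | allSet φ ih =>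
    intros; simp only [Formula.subst, Formula.Realize, ih, snoc_comp_snoc]
  | exSet φ ih =>
    intros; simp only [Formula.subst, Formula.Realize, ih, snoc_comp_snoc]

/-- Keeps the bound of a bounded quantifier in the shape `t.weaken` that `IsBounded` demands. -/
theorem Term.weaken_subst {m m' : ℕ} (σ : Fin m → Term m') (t : Term m) :
    t.weaken.subst (Fin.snoc (α := fun _ : Fin (m + 1) => Term (m' + 1))
      (fun i => (σ i).weaken) (.var (Fin.last m'))) = (t.subst σ).weaken := by
  simp [Term.weaken, Term.subst_subst, Term.subst]

theorem Formula.IsBounded.subst {m k : ℕ} {φ : Formula m k} (h : φ.IsBounded) :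
    ∀ {m' k' : ℕ} (σ : Fin m → Term m') (ρ : Fin k → Fin k'), (φ.subst σ ρ).IsBounded := by
  induction h with
  | eq t u => intros; exact .eq _ _
  | lt t u => intros; exact .lt _ _
  | mem t X => intros; exact .mem _ _
  | not _ ih => intros; exact .not (ih _ _)
  | and _ _ ih₁ ih₂ => intros; exact .and (ih₁ _ _) (ih₂ _ _)
  | or _ _ ih₁ ih₂ => intros; exact .or (ih₁ _ _) (ih₂ _ _)
  | imp _ _ ih₁ ih₂ => intros; exact .imp (ih₁ _ _) (ih₂ _ _)
  | ball t _ ih =>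
    intro m' k' σ ρ
    simp only [Formula.subst, Term.weaken_subst, Term.subst, Fin.snoc_last]
    exact .ball _ (ih _ _)
  | bex t _ ih =>
    intro m' k' σ ρ
    simp only [Formula.subst, Term.weaken_subst, Term.subst, Fin.snoc_last]
    exact .bex _ (ih _ _)

theorem Formula.realize_closeNum (M : L2Structure) {k : ℕ} (s : Fin k → M.Sets) :
    ∀ {m : ℕ} (φ : Formula m k) (e₀ : Fin 0 → M.Num),
      φ.closeNum.Realize M e₀ s ↔ ∀ e, φ.Realize M e s
  | 0, φ, e₀ => by
    rw [Formula.closeNum]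
    exact ⟨fun h e => Subsingleton.elim e₀ e ▸ h, fun h => h _⟩
  | m + 1, φ, e₀ => by
    rw [Formula.closeNum, Formula.realize_closeNum M s (.all φ) e₀]
    refine ⟨fun h e => ?_, fun h e a => h _⟩
    have := h (Fin.init e) (e (Fin.last m))
    rwa [Fin.snoc_init_self] at this

theorem Formula.realize_closeSet (M : L2Structure) :
    ∀ {k : ℕ} (φ : Formula 0 k), M.Satisfies φ.closeSet ↔ ∀ s, φ.Realize M Fin.elim0 s
  | 0, φ => by
    rw [Formula.closeSet]
    exact ⟨fun h s => Subsingleton.elim Fin.elim0 s ▸ h, fun h => h _⟩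
  | k + 1, φ => by
    rw [Formula.closeSet, Formula.realize_closeSet M (.allSet φ)]
    refine ⟨fun h s => ?_, fun h s A => h _⟩
    have := h (Fin.init s) (s (Fin.last k))
    rwa [Fin.snoc_init_self] at this

theorem Formula.satisfies_closure (M : L2Structure) {m k : ℕ} (φ : Formula m k) :
    M.Satisfies φ.closure ↔ ∀ e s, φ.Realize M e s := by
  rw [Formula.closure, Formula.realize_closeSet]
  simp only [Formula.realize_closeNum]
  exact forall_comm

theorem Formula.realize_atZero (M : L2Structure) {m k : ℕ} (φ : Formula (m + 1) k)
    (e : Fin m → M.Num) (s : Fin k → M.Sets) : φ.atZero.Realize M e s ↔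
      φ.Realize M (Fin.snoc (α := fun _ : Fin (m + 1) => M.Num) e M.zero) s := by
  rw [Formula.atZero, Formula.realize_subst]
  have : (fun i => (Fin.snoc (α := fun _ : Fin (m + 1) => Term m) (fun i => Term.var i)
      Term.zero i : Term m).eval M e) =
      Fin.snoc (α := fun _ : Fin (m + 1) => M.Num) e M.zero := by
    funext i
    refine Fin.lastCases ?_ (fun i => ?_) i <;> simp [Term.eval]
  rw [this]; rfl

theorem Formula.realize_atSucc (M : L2Structure) {m k : ℕ} (φ : Formula (m + 1) k)
    (e : Fin m → M.Num) (a : M.Num) (s : Fin k → M.Sets) :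
    φ.atSucc.Realize M (Fin.snoc (α := fun _ : Fin (m + 1) => M.Num) e a) s ↔
      φ.Realize M (Fin.snoc (α := fun _ : Fin (m + 1) => M.Num) e (M.add a M.one)) s := by
  rw [Formula.atSucc, Formula.realize_subst]
  have : (fun i => (Fin.snoc (α := fun _ : Fin (m + 1) => Term (m + 1))
      (fun i => Term.var i.castSucc) (.add (.var (Fin.last m)) .one) i : Term (m + 1)).eval M
        (Fin.snoc (α := fun _ : Fin (m + 1) => M.Num) e a)) =
      Fin.snoc (α := fun _ : Fin (m + 1) => M.Num) e (M.add a M.one) := by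
    funext i
    refine Fin.lastCases ?_ (fun i => ?_) i <;> simp [Term.eval]
  rw [this]; rfl

theorem Formula.realize_weakenSet (M : L2Structure) {m k : ℕ} (φ : Formula m k)
    (e : Fin m → M.Num) (s : Fin k → M.Sets) (A : M.Sets) :
    φ.weakenSet.Realize M e (Fin.snoc (α := fun _ : Fin (k + 1) => M.Sets) s A) ↔
      φ.Realize M e s := by
  rw [Formula.weakenSet, Formula.realize_subst]
  simp [Term.eval]

theorem realize_existsSetOf (M : L2Structure) {m k : ℕ} (φ : Formula (m + 1) k)
    (e : Fin m → M.Num) (s : Fin k → M.Sets) : (existsSetOf φ).Realize M e s ↔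
      ∃ A : M.Sets, ∀ a : M.Num,
        M.mem a A ↔ φ.Realize M (Fin.snoc (α := fun _ : Fin (m + 1) => M.Num) e a) s := by
  simp only [existsSetOf, Formula.Realize, Formula.iff, Formula.realize_weakenSet, Term.eval,
    Fin.snoc_last]
  exact exists_congr fun A => forall_congr' fun a => iff_def.symm

/-! ## The number sort of a model of `RCA₀` as an ordered semiring -/

/-- `M` is a model of `RCA₀`. -/
class IsRCA (M : L2Structure) : Prop where
  isModel : M.IsModel RCA0

section Algebra

variable (M : L2Structure) [hM : IsRCA M]

theorem num_laws :
    (∀ a b c : M.Num, M.add (M.add a b) c = M.add a (M.add b c)) ∧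
    (∀ a b : M.Num, M.add a b = M.add b a) ∧
    (∀ a b c : M.Num, M.mul (M.mul a b) c = M.mul a (M.mul b c)) ∧
    (∀ a b : M.Num, M.mul a b = M.mul b a) ∧
    (∀ a b c : M.Num, M.mul a (M.add b c) = M.add (M.mul a b) (M.mul a c)) ∧
    (∀ a : M.Num, M.add a M.zero = a) ∧
    (∀ a : M.Num, M.mul a M.zero = M.zero) ∧
    (∀ a : M.Num, M.mul a M.one = a) ∧
    (∀ a b c : M.Num, M.lt a b ∧ M.lt b c → M.lt a c) ∧
    (∀ a : M.Num, ¬ M.lt a a) ∧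
    (∀ a b : M.Num, M.lt a b ∨ a = b ∨ M.lt b a) ∧
    (∀ a b c : M.Num, M.lt a b → M.lt (M.add a c) (M.add b c)) ∧
    (∀ a b c : M.Num, M.lt M.zero c ∧ M.lt a b → M.lt (M.mul a c) (M.mul b c)) ∧
    (∀ a b : M.Num, M.lt a b → ∃ c, M.add a c = b) ∧
    M.lt M.zero M.one ∧
    (∀ a : M.Num, M.lt M.zero a ∨ M.zero = a) ∧
    (∀ a : M.Num, M.lt M.zero a → M.lt M.one a ∨ M.one = a) := by
  have h : ∀ φ ∈ basicAxioms, M.Satisfies φ := fun φ hφ => hM.isModel φ (Or.inl (Or.inl hφ))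
  simp only [basicAxioms, Set.mem_insert_iff, forall_eq_or_imp, forall_eq, Set.mem_singleton_iff,
    Formula.satisfies_closure] at h
  obtain ⟨h₁, h₂, h₃, h₄, h₅, h₆, h₇, h₈, h₉, h₁₀, h₁₁, h₁₂, h₁₃, h₁₄, h₁₅, h₁₆, h₁₇⟩ := h
  -- At an explicit environment the truth definition unfolds each axiom to the corresponding law.
  exact ⟨fun a b c => h₁ ![a, b, c] Fin.elim0, fun a b => h₂ ![a, b] Fin.elim0,
    fun a b c => h₃ ![a, b, c] Fin.elim0, fun a b => h₄ ![a, b] Fin.elim0,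
    fun a b c => h₅ ![a, b, c] Fin.elim0, fun a => h₆ ![a] Fin.elim0,
    fun a => h₇ ![a] Fin.elim0, fun a => h₈ ![a] Fin.elim0,
    fun a b c => h₉ ![a, b, c] Fin.elim0, fun a => h₁₀ ![a] Fin.elim0,
    fun a b => h₁₁ ![a, b] Fin.elim0, fun a b c => h₁₂ ![a, b, c] Fin.elim0,
    fun a b c => h₁₃ ![a, b, c] Fin.elim0, fun a b => h₁₄ ![a, b] Fin.elim0,
    h₁₅ Fin.elim0 Fin.elim0, fun a => h₁₆ ![a] Fin.elim0, fun a => h₁₇ ![a] Fin.elim0⟩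

noncomputable instance : CommSemiring M.Num where
  add := M.add
  mul := M.mul
  zero := M.zero
  one := M.one
  nsmul := @nsmulRec _ ⟨M.zero⟩ ⟨M.add⟩
  add_assoc := (num_laws M).1
  add_comm := (num_laws M).2.1
  mul_assoc := (num_laws M).2.2.1
  mul_comm := (num_laws M).2.2.2.1
  left_distrib := (num_laws M).2.2.2.2.1
  right_distrib a b c := by
    obtain ⟨-, -, -, hc, hd, -⟩ := num_laws M
    change M.mul (M.add a b) c = M.add (M.mul a c) (M.mul b c)
    rw [hc, hd, hc c a, hc c b]
  add_zero := (num_laws M).2.2.2.2.2.1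
  zero_add a := by
    obtain ⟨-, hc, -, -, -, h0, -⟩ := num_laws M
    exact (hc _ _).trans (h0 a)
  mul_zero := (num_laws M).2.2.2.2.2.2.1
  zero_mul a := by
    obtain ⟨-, -, -, hc, -, -, h0, -⟩ := num_laws M
    exact (hc _ _).trans (h0 a)
  mul_one := (num_laws M).2.2.2.2.2.2.2.1
  one_mul a := by
    obtain ⟨-, -, -, hc, -, -, -, h1, -⟩ := num_laws M
    exact (hc _ _).trans (h1 a)

open Classical in
noncomputable instance : LinearOrder M.Num where
  lt := M.lt
  le a b := M.lt a b ∨ a = b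
  le_refl a := .inr rfl
  le_trans a b c := by
    obtain ⟨-, -, -, -, -, -, -, -, ht, -⟩ := num_laws M
    rintro (h | rfl) (h' | rfl)
    exacts [.inl (ht _ _ _ ⟨h, h'⟩), .inl h, .inl h', .inr rfl]
  le_antisymm a b := by
    obtain ⟨-, -, -, -, -, -, -, -, ht, hi, -⟩ := num_laws M
    rintro (h | h) (h' | h')
    exacts [(hi _ (ht _ _ _ ⟨h, h'⟩)).elim, h'.symm, h, h]
  lt_iff_le_not_ge a b := by
    obtain ⟨-, -, -, -, -, -, -, -, ht, hi, -⟩ := num_laws M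
    refine ⟨fun h => ⟨.inl h, ?_⟩, ?_⟩
    · rintro (h' | rfl)
      exacts [hi _ (ht _ _ _ ⟨h, h'⟩), hi _ h]
    · rintro ⟨h | rfl, h'⟩
      exacts [h, (h' (.inr rfl)).elim]
  le_total a b := by
    obtain ⟨-, -, -, -, -, -, -, -, -, -, hl, -⟩ := num_laws M
    rcases hl a b with h | h | h
    exacts [.inl (.inl h), .inl (.inr h), .inr (.inl h)]
  toDecidableLE := fun _ _ => Classical.dec _

instance : Membership M.Num M.Sets := ⟨fun X n => M.mem n X⟩

theorem num_lt_add_right {a b : M.Num} (h : a < b) (c : M.Num) : a + c < b + c := by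
  obtain ⟨-, -, -, -, -, -, -, -, -, -, -, ha, -⟩ := num_laws M
  exact ha a b c h

instance : IsStrictOrderedRing M.Num := by
  obtain ⟨-, -, -, -, -, -, -, -, -, -, -, -, hm, -, h01, -⟩ := num_laws M
  exact
  { add_le_add_left := fun a b h c => by
      rcases h with h | rfl
      · exact (num_lt_add_right M h c).le
      · exact le_rfl
    le_of_add_le_add_left := fun a b c h => by
      by_contra hlt
      rw [not_le] at hlt
      have := num_lt_add_right M hlt a
      rw [add_comm c a, add_comm b a] at this
      exact absurd h (not_le.2 this)
    zero_le_one := .inl h01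
    exists_pair_ne := ⟨0, 1, (show (0 : M.Num) < 1 from h01).ne⟩
    mul_lt_mul_of_pos_left := fun a ha b c h => by
      rw [mul_comm a b, mul_comm a c]
      exact hm _ _ _ ⟨ha, h⟩
    mul_lt_mul_of_pos_right := fun a ha b c h => hm _ _ _ ⟨ha, h⟩ }

instance : CanonicallyOrderedAdd M.Num := by
  obtain ⟨-, -, -, -, -, -, -, -, -, -, -, -, -, he, -, h0, -⟩ := num_laws M
  have h0' (a : M.Num) : 0 ≤ a := h0 a
  exact
  { exists_add_of_le := fun {a b} h => by
      rcases h with h | rfl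
      · obtain ⟨c, hc⟩ := he _ _ h
        exact ⟨c, hc.symm⟩
      · exact ⟨0, (add_zero a).symm⟩
    le_add_self := fun a b => le_add_of_nonneg_left (h0' b)
    le_self_add := fun a b => le_add_of_nonneg_right (h0' b) }

theorem num_one_le {a : M.Num} (h : 0 < a) : 1 ≤ a := by
  obtain ⟨-, -, -, -, -, -, -, -, -, -, -, -, -, -, -, -, h1⟩ := num_laws M
  exact h1 a h

theorem num_add_one_le {a b : M.Num} (h : a < b) : a + 1 ≤ b := by
  obtain ⟨c, rfl⟩ := exists_add_of_le h.le
  have : 0 < c := pos_of_lt_add_right h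
  gcongr
  exact num_one_le M this

/-- This is discreteness. It makes `a < b + 1` and `a ≤ b` interchangeable, which is why later
bounds have the form `w + 1`. -/
noncomputable instance : SuccOrder M.Num where
  succ a := a + 1
  le_succ _ := le_self_add
  max_of_succ_le {a} h := (not_le.2 (lt_add_one a) h).elim
  succ_le_of_lt h := num_add_one_le M h

noncomputable instance : SuccAddOrder M.Num := ⟨fun _ => rfl⟩

end Algebra

/-! ## Relations definable by bounded formulas with parameters -/

section Definability

variable {M : L2Structure}

/-- `f` is the value of a term with the parameters `a`. -/
def TermDefWith {m p : ℕ} (a : Fin p → M.Num) (f : (Fin m → M.Num) → M.Num) : Prop :=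
  ∃ t : Term (p + m), ∀ e, t.eval M (Fin.append a e) = f e

/-- `f` is the value of a term with parameters. -/
def TermDef {m : ℕ} (f : (Fin m → M.Num) → M.Num) : Prop :=
  ∃ (p : ℕ) (a : Fin p → M.Num), TermDefWith a f

/-- `P` is defined by a bounded formula with the number parameters `a` and set parameters `s`. -/
def BddDefWith {m p k : ℕ} (a : Fin p → M.Num) (s : Fin k → M.Sets)
    (P : (Fin m → M.Num) → Prop) : Prop :=
  ∃ φ : Formula (p + m) k, φ.IsBounded ∧ ∀ e, φ.Realize M (Fin.append a e) s ↔ P e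

/-- `P` is defined by a bounded formula with parameters. -/
def BddDef {m : ℕ} (P : (Fin m → M.Num) → Prop) : Prop :=
  ∃ (p k : ℕ) (a : Fin p → M.Num) (s : Fin k → M.Sets), BddDefWith a s P

/-- The inclusion of the variables and the first block of parameters. -/
def embLeft {p m : ℕ} (q : ℕ) : Fin (p + m) → Fin (p + q + m) :=
  Fin.addCases (fun i => Fin.castAdd m (Fin.castAdd q i)) (Fin.natAdd (p + q))

/-- The inclusion of the variables and the second block of parameters. -/
def embRight {q m : ℕ} (p : ℕ) : Fin (q + m) → Fin (p + q + m) :=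
  Fin.addCases (fun i => Fin.castAdd m (Fin.natAdd p i)) (Fin.natAdd (p + q))

theorem append_embLeft {A : Type*} {p q m : ℕ} (a : Fin p → A) (b : Fin q → A) (e : Fin m → A) :
    (fun i => Fin.append (Fin.append a b) e (embLeft q i)) = Fin.append a e := by
  funext i
  refine Fin.addCases (fun i => ?_) (fun i => ?_) i <;> simp [embLeft]

theorem append_embRight {A : Type*} {p q m : ℕ} (a : Fin p → A) (b : Fin q → A) (e : Fin m → A) :
    (fun i => Fin.append (Fin.append a b) e (embRight p i)) = Fin.append b e := by
  funext i
  refine Fin.addCases (fun i => ?_) (fun i => ?_) i <;> simp [embRight]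

theorem TermDefWith.left {m p q : ℕ} {a : Fin p → M.Num} {f : (Fin m → M.Num) → M.Num}
    (h : TermDefWith a f) (b : Fin q → M.Num) : TermDefWith (Fin.append a b) f := by
  obtain ⟨t, ht⟩ := h
  refine ⟨t.subst fun i => .var (embLeft q i), fun e => ?_⟩
  rw [Term.eval_subst, ← ht e, ← append_embLeft a b e]
  rfl

theorem TermDefWith.right {m p q : ℕ} {b : Fin q → M.Num} {f : (Fin m → M.Num) → M.Num}
    (h : TermDefWith b f) (a : Fin p → M.Num) : TermDefWith (Fin.append a b) f := by
  obtain ⟨t, ht⟩ := h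
  refine ⟨t.subst fun i => .var (embRight p i), fun e => ?_⟩
  rw [Term.eval_subst, ← ht e, ← append_embRight a b e]
  rfl

theorem BddDefWith.left {m p q k l : ℕ} {a : Fin p → M.Num} {s : Fin k → M.Sets}
    {P : (Fin m → M.Num) → Prop} (h : BddDefWith a s P) (b : Fin q → M.Num)
    (s' : Fin l → M.Sets) : BddDefWith (Fin.append a b) (Fin.append s s') P := by
  obtain ⟨φ, hφ, h⟩ := h
  refine ⟨φ.subst (fun i => .var (embLeft q i)) (Fin.castAdd l), hφ.subst _ _, fun e => ?_⟩
  rw [Formula.realize_subst, ← h e, ← append_embLeft a b e]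
  simp only [Fin.append_left]
  rfl

theorem BddDefWith.right {m p q k l : ℕ} {b : Fin q → M.Num} {s' : Fin l → M.Sets}
    {P : (Fin m → M.Num) → Prop} (h : BddDefWith b s' P) (a : Fin p → M.Num)
    (s : Fin k → M.Sets) : BddDefWith (Fin.append a b) (Fin.append s s') P := by
  obtain ⟨φ, hφ, h⟩ := h
  refine ⟨φ.subst (fun i => .var (embRight p i)) (Fin.natAdd k), hφ.subst _ _, fun e => ?_⟩
  rw [Formula.realize_subst, ← h e, ← append_embRight a b e]
  simp only [Fin.append_right]
  rfl

/-- Two terms can be combined only over one list of parameters, so each is renamed into the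
concatenated list. -/
theorem TermDef.common {m n : ℕ} {f : (Fin m → M.Num) → M.Num} {g : (Fin n → M.Num) → M.Num}
    (hf : TermDef f) (hg : TermDef g) :
    ∃ (p : ℕ) (a : Fin p → M.Num), TermDefWith a f ∧ TermDefWith a g := by
  obtain ⟨p, a, hf⟩ := hf
  obtain ⟨q, b, hg⟩ := hg
  exact ⟨p + q, Fin.append a b, hf.left b, hg.right a⟩

theorem BddDef.common {m n : ℕ} {P : (Fin m → M.Num) → Prop} {Q : (Fin n → M.Num) → Prop}
    (hP : BddDef P) (hQ : BddDef Q) : ∃ (p k : ℕ) (a : Fin p → M.Num) (s : Fin k → M.Sets),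
      BddDefWith a s P ∧ BddDefWith a s Q := by
  obtain ⟨p, k, a, s, hP⟩ := hP
  obtain ⟨q, l, b, s', hQ⟩ := hQ
  exact ⟨p + q, k + l, Fin.append a b, Fin.append s s', hP.left b s', hQ.right a s⟩

theorem TermDef.common_bddDef {m n : ℕ} {f : (Fin m → M.Num) → M.Num} {Q : (Fin n → M.Num) → Prop}
    (hf : TermDef f) (hQ : BddDef Q) : ∃ (p k : ℕ) (a : Fin p → M.Num) (s : Fin k → M.Sets),
      TermDefWith a f ∧ BddDefWith a s Q := by
  obtain ⟨p, a, hf⟩ := hf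
  obtain ⟨q, l, b, s, hQ⟩ := hQ
  exact ⟨p + q, 0 + l, Fin.append a b, Fin.append Fin.elim0 s, hf.left b, hQ.right a _⟩

/-- Parameters come first, so a variable bound by a quantifier is last both among the variables and
in the whole environment. -/
theorem append_right_snoc {A : Type*} {p m : ℕ} (a : Fin p → A) (e : Fin m → A) (x : A) :
    (Fin.append a (Fin.snoc (α := fun _ : Fin (m + 1) => A) e x) : Fin (p + (m + 1)) → A) =
      Fin.snoc (α := fun _ : Fin (p + m + 1) => A) (Fin.append a e) x := by
  funext i
  refine Fin.lastCases ?_ (fun i => ?_) i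
  · exact (Fin.append_right a _ (Fin.last m)).trans
      ((Fin.snoc_last ..).trans (Fin.snoc_last (α := fun _ : Fin (p + m + 1) => A) ..).symm)
  · refine Eq.trans ?_ (Fin.snoc_castSucc (α := fun _ : Fin (p + m + 1) => A) ..).symm
    refine Fin.addCases (fun i => ?_) (fun i => ?_) i
    · exact (Fin.append_left a _ i).trans (Fin.append_left a e i).symm
    · exact (Fin.append_right a _ i.castSucc).trans
        ((Fin.snoc_castSucc ..).trans (Fin.append_right a e i).symm)

/-! ### Terms -/

theorem TermDef.var {m : ℕ} (i : Fin m) : TermDef fun e : Fin m → M.Num => e i :=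
  ⟨0, Fin.elim0, .var (Fin.natAdd 0 i), fun e => by simp [Term.eval]⟩

theorem TermDef.const {m : ℕ} (c : M.Num) : TermDef fun _ : Fin m → M.Num => c :=
  ⟨1, fun _ => c, .var (Fin.castAdd m 0), fun e => by simp [Term.eval]⟩

theorem TermDef.weaken {m : ℕ} {f : (Fin m → M.Num) → M.Num} (hf : TermDef f) :
    TermDef fun e : Fin (m + 1) → M.Num => f fun i => e i.castSucc := by
  obtain ⟨p, a, t, ht⟩ := hf
  refine ⟨p, a, t.weaken, fun e => ?_⟩
  rw [← Fin.snoc_init_self e]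
  refine (congrArg (fun v => t.weaken.eval M v) (append_right_snoc a _ _)).trans ?_
  rw [Term.eval_weaken, ht]
  simp

/-! ### Formulas -/

theorem BddDef.congr {m : ℕ} {P Q : (Fin m → M.Num) → Prop} (hP : BddDef P)
    (h : ∀ e, P e ↔ Q e) : BddDef Q := by
  rwa [← show P = Q from funext fun e => propext (h e)]

theorem BddDef.mem {m : ℕ} {f : (Fin m → M.Num) → M.Num} (hf : TermDef f) (X : M.Sets) :
    BddDef fun e => f e ∈ X := by
  obtain ⟨p, a, t, ht⟩ := hf
  exact ⟨p, 1, a, fun _ => X, .mem t 0, .mem _ _, fun e => by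
    simp only [Formula.Realize, ht]; rfl⟩

theorem BddDef.eq {m : ℕ} {f g : (Fin m → M.Num) → M.Num} (hf : TermDef f) (hg : TermDef g) :
    BddDef fun e => f e = g e := by
  obtain ⟨p, a, ⟨t, ht⟩, ⟨u, hu⟩⟩ := hf.common hg
  exact ⟨p, 0, a, Fin.elim0, .eq t u, .eq _ _, fun e => by simp [Formula.Realize, ht, hu]⟩

theorem BddDef.not {m : ℕ} {P : (Fin m → M.Num) → Prop} (hP : BddDef P) :
    BddDef fun e => ¬ P e := by
  obtain ⟨p, k, a, s, φ, hφ, h⟩ := hP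
  exact ⟨p, k, a, s, .not φ, .not hφ, fun e => by simp [Formula.Realize, h]⟩

theorem BddDef.and {m : ℕ} {P Q : (Fin m → M.Num) → Prop} (hP : BddDef P) (hQ : BddDef Q) :
    BddDef fun e => P e ∧ Q e := by
  obtain ⟨p, k, a, s, ⟨φ, hφ, h⟩, ⟨ψ, hψ, h'⟩⟩ := hP.common hQ
  exact ⟨p, k, a, s, .and φ ψ, .and hφ hψ, fun e => by simp [Formula.Realize, h, h']⟩

theorem BddDef.or {m : ℕ} {P Q : (Fin m → M.Num) → Prop} (hP : BddDef P) (hQ : BddDef Q) :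
    BddDef fun e => P e ∨ Q e :=
  (hP.not.and hQ.not).not.congr fun e => by tauto

theorem BddDef.imp {m : ℕ} {P Q : (Fin m → M.Num) → Prop} (hP : BddDef P) (hQ : BddDef Q) :
    BddDef fun e => P e → Q e :=
  (hP.not.or hQ).congr fun e => by tauto

theorem BddDef.iff {m : ℕ} {P Q : (Fin m → M.Num) → Prop} (hP : BddDef P) (hQ : BddDef Q) :
    BddDef fun e => (P e ↔ Q e) :=
  ((hP.imp hQ).and (hQ.imp hP)).congr fun _ => iff_def.symm

/-- P does not depend on the variables, so whatever it says, it can be replaced by its truth value.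
-/
theorem BddDef.prop {m : ℕ} (P : Prop) : BddDef fun _ : Fin m → M.Num => P := by
  by_cases hP : P
  · exact (BddDef.eq (.const M.zero) (.const M.zero)).congr fun _ => by simp [hP]
  · exact (BddDef.eq (.const M.zero) (.const M.zero)).not.congr fun _ => by simp [hP]

theorem BddDef.subst {m m' : ℕ} {P : (Fin m → M.Num) → Prop} (hP : BddDef P)
    (σ : Fin m → Term m') : BddDef fun e => P fun i => (σ i).eval M e := by
  obtain ⟨p, k, a, s, φ, hφ, h⟩ := hP
  refine ⟨p, k, a, s, φ.subst (Fin.addCases (fun i => .var (Fin.castAdd m' i))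
    fun i => (σ i).subst fun j => .var (Fin.natAdd p j)) id, hφ.subst _ _, fun e => ?_⟩
  refine Iff.trans ?_ (h _)
  rw [Formula.realize_subst]
  have : (fun i => (Fin.addCases (motive := fun _ => Term (p + m'))
      (fun i => Term.var (Fin.castAdd m' i))
      (fun i => (σ i).subst fun j => .var (Fin.natAdd p j)) i : Term (p + m')).eval M
        (Fin.append a e)) = Fin.append a fun i => (σ i).eval M e := by
    funext i
    refine Fin.addCases (fun i => ?_) (fun i => ?_) i <;> simp [Term.eval, Term.eval_subst]
  rw [this]; rfl

/-- A realization of a bounded formula is a bounded relation. -/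
theorem BddDef.of_isBounded {m k : ℕ} {φ : Formula m k} (hφ : φ.IsBounded) (s : Fin k → M.Sets) :
    BddDef fun e => φ.Realize M e s := by
  refine ⟨0, k, Fin.elim0, s, φ.subst (fun i => .var (Fin.natAdd 0 i)) id, hφ.subst _ _,
    fun e => ?_⟩
  rw [Formula.realize_subst]
  simp [Term.eval]

variable [IsRCA M]

theorem TermDef.add {m : ℕ} {f g : (Fin m → M.Num) → M.Num} (hf : TermDef f) (hg : TermDef g) :
    TermDef fun e => f e + g e := by
  obtain ⟨p, a, ⟨t, ht⟩, ⟨u, hu⟩⟩ := hf.common hg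
  exact ⟨p, a, .add t u, fun e => by simp only [Term.eval, ht, hu]; rfl⟩

theorem TermDef.mul {m : ℕ} {f g : (Fin m → M.Num) → M.Num} (hf : TermDef f) (hg : TermDef g) :
    TermDef fun e => f e * g e := by
  obtain ⟨p, a, ⟨t, ht⟩, ⟨u, hu⟩⟩ := hf.common hg
  exact ⟨p, a, .mul t u, fun e => by simp only [Term.eval, ht, hu]; rfl⟩

theorem BddDef.lt {m : ℕ} {f g : (Fin m → M.Num) → M.Num} (hf : TermDef f) (hg : TermDef g) :
    BddDef fun e => f e < g e := by
  obtain ⟨p, a, ⟨t, ht⟩, ⟨u, hu⟩⟩ := hf.common hg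
  exact ⟨p, 0, a, Fin.elim0, .lt t u, .lt _ _, fun e => by
    simp only [Formula.Realize, ht, hu]; rfl⟩

theorem BddDef.le {m : ℕ} {f g : (Fin m → M.Num) → M.Num} (hf : TermDef f) (hg : TermDef g) :
    BddDef fun e => f e ≤ g e :=
  (BddDef.lt hg hf).not.congr fun _ => not_lt

theorem BddDef.ex_lt {m : ℕ} {f : (Fin m → M.Num) → M.Num} {Q : (Fin m → M.Num) → M.Num → Prop}
    (hf : TermDef f)
    (hQ : BddDef fun e : Fin (m + 1) → M.Num => Q (fun i => e i.castSucc) (e (Fin.last m))) :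
    BddDef fun e => ∃ x, x < f e ∧ Q e x := by
  obtain ⟨p, k, a, s, ⟨t, ht⟩, ⟨φ, hφ, h⟩⟩ := hf.common_bddDef hQ
  refine ⟨p, k, a, s, .ex (.and (.lt (.var (Fin.last (p + m))) t.weaken) φ), .bex t hφ,
    fun e => ?_⟩
  simp only [Formula.Realize, Term.eval_weaken, ht, Term.eval, Fin.snoc_last]
  refine exists_congr fun x => and_congr Iff.rfl ?_
  rw [← append_right_snoc]
  refine (h _).trans ?_
  simp

theorem BddDef.all_lt {m : ℕ} {f : (Fin m → M.Num) → M.Num} {Q : (Fin m → M.Num) → M.Num → Prop}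
    (hf : TermDef f)
    (hQ : BddDef fun e : Fin (m + 1) → M.Num => Q (fun i => e i.castSucc) (e (Fin.last m))) :
    BddDef fun e => ∀ x, x < f e → Q e x :=
  (BddDef.ex_lt (Q := fun e x => ¬ Q e x) hf hQ.not).not.congr fun e => by push Not; rfl

end Definability

section Arithmetic

variable {M : L2Structure} [hM : IsRCA M]

/-- The code of the ordered pair `(x, y)`. -/
noncomputable def pair (x y : M.Num) : M.Num := (x + y) * (x + y) + x

theorem TermDef.pair {m : ℕ} {f g : (Fin m → M.Num) → M.Num} (hf : TermDef f) (hg : TermDef g) :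
    TermDef fun e => pair (f e) (g e) :=
  ((hf.add hg).mul (hf.add hg)).add hf

/-- Bounded definability of a relation, from its syntactic form. -/
theorem BddDef.auto {M : L2Structure} {m : ℕ} {P : (Fin m → M.Num) → Prop} (h : BddDef P := by
    apply_rules [BddDef.mem, BddDef.eq, BddDef.lt, BddDef.le, BddDef.and, BddDef.or, BddDef.iff,
      BddDef.ex_lt, BddDef.all_lt, BddDef.not, BddDef.imp, TermDef.pair, TermDef.add, TermDef.mul,
      TermDef.var, TermDef.const, BddDef.prop]) : BddDef P := h

theorem append_snoc_snoc {A : Type*} {p : ℕ} (a : Fin p → A) (x y : A) :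
    Fin.snoc (α := fun _ : Fin (p + 2) => A) (Fin.snoc (α := fun _ : Fin (p + 1) => A) a x) y =
      Fin.append a ![x, y] := by
  have h : ![x, y] = Fin.snoc (α := fun _ : Fin 2 => A)
      (Fin.snoc (α := fun _ : Fin 1 => A) Fin.elim0 x) y := by
    funext i; fin_cases i <;> rfl
  rw [h, append_right_snoc, append_right_snoc, Fin.append_elim0]
  rfl

/-! ### Comprehension and induction -/

theorem exists_set_of_delta1 {P Q : M.Num → M.Num → Prop}
    (hP : BddDef fun e : Fin 2 → M.Num => P (e 0) (e 1))
    (hQ : BddDef fun e : Fin 2 → M.Num => Q (e 0) (e 1))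
    (h : ∀ n, (∃ z, P n z) ↔ ∀ z, Q n z) : ∃ X : M.Sets, ∀ n, n ∈ X ↔ ∃ z, P n z := by
  obtain ⟨p, k, a, s, ⟨φ, hφ, hφP⟩, ⟨ψ, hψ, hψQ⟩⟩ := hP.common hQ
  have key := (Formula.satisfies_closure M _).1 (hM.isModel _ (Or.inr
    ⟨p, k, .ex φ, .all ψ, ⟨φ, hφ, rfl⟩, ⟨ψ, hψ, rfl⟩, rfl⟩)) a s
  simp only [Formula.Realize, realize_existsSetOf, Formula.iff, append_snoc_snoc, hφP, hψQ] at key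
  exact key fun n => iff_def.1 (h n)

theorem sigma1_induction {P : M.Num → M.Num → Prop}
    (hP : BddDef fun e : Fin 2 → M.Num => P (e 0) (e 1)) (h0 : ∃ z, P 0 z)
    (hs : ∀ n, (∃ z, P n z) → ∃ z, P (n + 1) z) (n : M.Num) : ∃ z, P n z := by
  obtain ⟨p, k, a, s, φ, hφ, hφP⟩ := hP
  have key := (Formula.satisfies_closure M _).1 (hM.isModel _ (Or.inl (Or.inr
    ⟨p, k, .ex φ, ⟨φ, hφ, rfl⟩, rfl⟩))) a s
  simp only [Formula.Realize, Formula.realize_atZero, Formula.realize_atSucc, append_snoc_snoc,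
    hφP] at key
  exact key ⟨h0, hs⟩ n

theorem exists_set {P : M.Num → Prop} (hP : BddDef fun e : Fin 1 → M.Num => P (e 0)) :
    ∃ X : M.Sets, ∀ n, n ∈ X ↔ P n := by
  have hP' : BddDef fun e : Fin 2 → M.Num => P (e 0) := hP.subst fun _ => .var 0
  obtain ⟨X, hX⟩ := exists_set_of_delta1 (P := fun n _ => P n) (Q := fun n _ => P n) hP' hP'
    fun n => ⟨fun ⟨_, h⟩ _ => h, fun h => ⟨0, h 0⟩⟩
  exact ⟨X, fun n => (hX n).trans ⟨fun ⟨_, h⟩ => h, fun h => ⟨0, h⟩⟩⟩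

theorem bdd_induction {P : M.Num → Prop} (hP : BddDef fun e : Fin 1 → M.Num => P (e 0))
    (h0 : P 0) (hs : ∀ n, P n → P (n + 1)) (n : M.Num) : P n := by
  have hP' : BddDef fun e : Fin 2 → M.Num => P (e 0) := hP.subst fun _ => .var 0
  obtain ⟨-, h⟩ := sigma1_induction (P := fun n _ => P n) hP' ⟨0, h0⟩
    (fun n ⟨_, h⟩ => ⟨0, hs n h⟩) n
  exact h

/-! ### Pairs -/

theorem left_le_pair (x y : M.Num) : x ≤ pair x y := le_add_self

theorem le_mul_self (a : M.Num) : a ≤ a * a := by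
  rcases eq_or_ne a 0 with rfl | h
  · simp
  · exact le_mul_of_one_le_right (zero_le) (num_one_le M (pos_iff_ne_zero.2 h))

theorem right_le_pair (x y : M.Num) : y ≤ pair x y :=
  le_add_self.trans ((le_mul_self (x + y)).trans le_self_add)

/-- With s = x + y, the code lies between s² and (s + 1)², so it determines s. -/
theorem pair_lt_pair {x y x' y' : M.Num} (h : x + y < x' + y') : pair x y < pair x' y' := by
  have h1 := num_add_one_le M h
  calc pair x y < (x + y + 1) * (x + y + 1) := by
        have : (x + y + 1) * (x + y + 1) = pair x y + (x + y + y + 1) := by unfold pair; ring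
        rw [this]
        exact lt_add_of_pos_right _ (by positivity)
    _ ≤ (x' + y') * (x' + y') := by gcongr
    _ ≤ pair x' y' := le_self_add

theorem pair_inj {x y x' y' : M.Num} (h : pair x y = pair x' y') : x = x' ∧ y = y' := by
  rcases lt_trichotomy (x + y) (x' + y') with hlt | heq | hlt
  · exact absurd h (pair_lt_pair hlt).ne
  · unfold pair at h
    rw [heq] at h
    obtain rfl := add_left_cancel h
    exact ⟨rfl, add_left_cancel heq⟩
  · exact absurd h (pair_lt_pair hlt).ne'

/-- The components of a pair are at most its code, so decoding needs only bounded quantifiers. -/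
theorem exists_rel {P : M.Num → M.Num → Prop}
    (hP : BddDef fun e : Fin 2 → M.Num => P (e 0) (e 1)) :
    ∃ X : M.Sets, ∀ x y, pair x y ∈ X ↔ P x y := by
  have hP' : BddDef fun e : Fin 3 → M.Num => P (e 1) (e 2) := hP.subst ![.var 1, .var 2]
  obtain ⟨X, hX⟩ := exists_set (M := M)
    (P := fun w => ∃ x, x < w + 1 ∧ ∃ y, y < w + 1 ∧ w = pair x y ∧ P x y)
    (.ex_lt (.add (.var _) (.const _)) (.ex_lt (.add (.var _) (.const _))
      (.and (.eq (.var _) (.pair (.var _) (.var _))) hP')))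
  refine ⟨X, fun x y => (hX _).trans ⟨?_, fun h => ⟨x, ?_, y, ?_, rfl, h⟩⟩⟩
  · rintro ⟨x', -, y', -, he, h⟩
    obtain ⟨rfl, rfl⟩ := pair_inj he
    exact h
  · exact Order.lt_add_one_iff.2 (left_le_pair _ _)
  · exact Order.lt_add_one_iff.2 (right_le_pair _ _)

/-! ### Least number principle -/

/-- A nonempty `Σ⁰₁` class of numbers has a least element. -/
theorem sigma1_least (X : M.Sets) (h : ∃ k z, pair k z ∈ X) :
    ∃ k z, pair k z ∈ X ∧ ∀ k' z', pair k' z' ∈ X → k ≤ k' := by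
  by_contra hcon
  push Not at hcon
  obtain ⟨k₀, z₀, h₀⟩ := h
  -- Without a least element one can descend i times from k₀ for every i, which is absurd for i = k₀
  -- + 1. Since k is bounded by k₀ + 1, the witness z is the only unbounded quantifier.
  obtain ⟨z, k, -, hk, -⟩ := sigma1_induction (M := M)
    (P := fun i z => ∃ k, k < k₀ + 1 ∧ k + i ≤ k₀ ∧ pair k z ∈ X) .auto
    ⟨z₀, k₀, lt_add_one k₀, by simp, h₀⟩ (by
      rintro i ⟨z, k, hk, hki, hkz⟩
      obtain ⟨k', z', h', hlt⟩ := hcon k z hkz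
      refine ⟨z', k', hlt.trans hk, le_trans ?_ hki, h'⟩
      rw [add_comm i, ← add_assoc]
      gcongr
      exact num_add_one_le M hlt) (k₀ + 1)
  exact absurd hk (not_le.2 (lt_of_lt_of_le (lt_add_one k₀) le_add_self))

end Arithmetic

section Coding

variable {M : L2Structure} [hM : IsRCA M]

/-! ### Coding of bounded sets by divisibility -/

theorem num_dvd_of_dvd_add {a x y : M.Num} (h : a ∣ x + y) (hx : a ∣ x) : a ∣ y := by
  obtain ⟨u, rfl⟩ := hx
  obtain ⟨v, hv⟩ := h
  rcases eq_or_ne a 0 with rfl | ha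
  · exact ⟨0, by simpa using hv⟩
  have ha : 0 < a := pos_iff_ne_zero.2 ha
  have huv : u ≤ v := by
    by_contra hlt
    have := mul_lt_mul_of_pos_left (not_le.1 hlt) ha
    rw [← hv] at this
    exact absurd this (not_lt.2 le_self_add)
  obtain ⟨w, rfl⟩ := exists_add_of_le huv
  rw [mul_add] at hv
  exact ⟨w, add_left_cancel hv⟩

theorem dvd_iff_exists_lt {a b : M.Num} (ha : 0 < a) : a ∣ b ↔ ∃ q, q < b + 1 ∧ b = a * q := by
  refine ⟨fun ⟨q, hq⟩ => ⟨q, ?_, hq⟩, fun ⟨q, _, hq⟩ => ⟨q, hq⟩⟩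
  rw [Order.lt_add_one_iff, hq]
  exact le_mul_of_one_le_left zero_le (num_one_le M ha)

/-- The moduli `1 + (i + 1) d`, pairwise coprime for `i < b` if `d` is divisible by `1, …, b`. -/
noncomputable def modulus (d i : M.Num) : M.Num := 1 + (i + 1) * d

theorem modulus_pos (d i : M.Num) : 0 < modulus d i := by
  unfold modulus; positivity

theorem one_lt_modulus {d : M.Num} (hd : 0 < d) (i : M.Num) : 1 < modulus d i :=
  lt_add_of_pos_right _ (by positivity)

/-- `i` is an element of the set coded by `c` and `d`. -/
def Coded (d c i : M.Num) : Prop := ∃ q, q < c + 1 ∧ c = modulus d i * q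

theorem coded_iff {d c i : M.Num} : Coded d c i ↔ modulus d i ∣ c :=
  (dvd_iff_exists_lt (modulus_pos d i)).symm

theorem BddDef.coded {m : ℕ} {f g h : (Fin m → M.Num) → M.Num} (hf : TermDef f) (hg : TermDef g)
    (hh : TermDef h) : BddDef fun e => Coded (f e) (g e) (h e) :=
  .ex_lt (hg.add (.const 1)) (.eq hg.weaken
    (.mul (.add (.const 1) (.mul (.add hh.weaken (.const 1)) hf.weaken)) (.var _)))

/-- A substitute for the factorial: it needs only `Σ⁰₁` induction, once divisibility is written with
a bounded quotient. -/
theorem exists_common_multiple (b : M.Num) : ∃ d : M.Num, 0 < d ∧ ∀ i < b, i + 1 ∣ d := by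
  have hpos (i : M.Num) : 0 < i + 1 := by positivity
  simp only [dvd_iff_exists_lt (hpos _)]
  refine sigma1_induction (M := M)
    (P := fun b d => 0 < d ∧ ∀ i, i < b → ∃ q, q < d + 1 ∧ d = (i + 1) * q) .auto ?_ ?_ b
  · exact ⟨1, zero_lt_one, fun i hi => absurd hi not_lt_zero⟩
  · simp only [← dvd_iff_exists_lt (hpos _)]
    rintro n ⟨d, hd, h⟩
    refine ⟨d * (n + 1), mul_pos hd (hpos n), fun i hi => ?_⟩
    rcases (Order.lt_add_one_iff.1 hi).lt_or_eq with hi | rfl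
    · exact (h i hi).mul_right _
    · exact dvd_mul_left _ _

/-- The modulus is 1 plus a multiple of d, so d can be cancelled. -/
theorem dvd_of_modulus_dvd_mul {d i x : M.Num} (h : modulus d i ∣ x * d) : modulus d i ∣ x := by
  have h1 : modulus d i ∣ (i + 1) * (x * d) + x := ⟨x, by unfold modulus; ring⟩
  exact num_dvd_of_dvd_add h1 (h.mul_left _)

/-- Two moduli differ by (t + 1) d, where t + 1 is the distance of i and j. Hence `modulus d i`
divides c (t + 1) d. Cancel d, multiply by the cofactor of t + 1 in d, and cancel d again. No primes
are needed. -/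
theorem dvd_of_modulus_dvd_mul_modulus {b d : M.Num} (hd : ∀ i < b, i + 1 ∣ d) {i j : M.Num}
    (hi : i < b) (hj : j < b) (hij : i ≠ j) {c : M.Num} (h : modulus d i ∣ c * modulus d j) :
    modulus d i ∣ c := by
  have key (t : M.Num) (ht : t < b) (h : modulus d i ∣ c * (t + 1) * d) : modulus d i ∣ c := by
    obtain ⟨r, hr⟩ := hd t ht
    have := (dvd_of_modulus_dvd_mul h).mul_right r
    rw [mul_assoc, ← hr] at this
    exact dvd_of_modulus_dvd_mul this
  rcases lt_or_gt_of_ne hij with hlt | hlt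
  · obtain ⟨t, rfl⟩ := exists_add_of_le (num_add_one_le M hlt)
    refine key t (lt_of_le_of_lt le_add_self hj) (num_dvd_of_dvd_add (x := c * modulus d i) ?_
      (dvd_mul_left _ _))
    convert h using 1
    unfold modulus; ring
  · obtain ⟨t, rfl⟩ := exists_add_of_le (num_add_one_le M hlt)
    refine key t (lt_of_le_of_lt le_add_self hi) (num_dvd_of_dvd_add ?_ h)
    exact ⟨c, by unfold modulus; ring⟩

/-- Every set is coded below any given bound. -/
theorem exists_code (X : M.Sets) (b : M.Num) : ∃ d c : M.Num, ∀ n < b, Coded d c n ↔ n ∈ X := by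
  obtain ⟨d, hd0, hd⟩ := exists_common_multiple b
  -- The code at j is the product of the moduli of the elements of X below both j and b; coprimality
  -- prevents other moduli from dividing it.
  obtain ⟨c, hc⟩ := sigma1_induction (M := M)
    (P := fun j c => ∀ n, n < b → (Coded d c n ↔ (n ∈ X ∧ n < j)))
    (.all_lt (.const _) (.iff (.coded (.const _) (.var _) (.var _)) .auto)) (by
      refine ⟨1, fun n _ => ?_⟩
      simp only [not_lt_zero, and_false, iff_false, coded_iff]
      intro hdvd
      obtain ⟨q, hq⟩ := hdvd
      have hq0 : q ≠ 0 := by rintro rfl; simp at hq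
      have := le_mul_of_one_le_right (zero_le (a := modulus d n))
        (num_one_le M (pos_iff_ne_zero.2 hq0))
      rw [← hq] at this
      exact absurd this (not_le.2 (one_lt_modulus hd0 n))) (by
      rintro j ⟨c, hc⟩
      by_cases hj : j ∈ X ∧ j < b
      · refine ⟨c * modulus d j, fun n hn => ?_⟩
        rcases eq_or_ne n j with rfl | hne
        · simp [coded_iff, hj.1, dvd_mul_left]
        · rw [coded_iff, Order.lt_add_one_iff, hne.le_iff_lt, ← hc n hn, coded_iff]
          exact ⟨dvd_of_modulus_dvd_mul_modulus hd hn hj.2 hne, fun h => h.mul_right _⟩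
      · refine ⟨c, fun n hn => ?_⟩
        rw [hc n hn, Order.lt_add_one_iff]
        refine and_congr_right fun hX => ⟨le_of_lt, fun h => h.lt_of_ne ?_⟩
        rintro rfl
        exact hj ⟨hX, hn⟩) b
  exact ⟨d, c, fun n hn => by rw [hc n hn]; exact and_iff_left hn⟩

/-- Strong `Σ⁰₁` collection. -/
theorem strong_collection (X : M.Sets) (y : M.Num) :
    ∃ b : M.Num, ∀ n < y, (∃ z, pair n z ∈ X) → ∃ z < b, pair n z ∈ X := by
  obtain ⟨d, hd0, hd⟩ := exists_common_multiple y
  -- Here k records, by its divisors among the moduli, the n < y that may still lack a witness below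
  -- b. For the least such k, an n with a witness but none below b would allow `modulus d n` to be
  -- divided out after raising b.
  obtain ⟨R, hR⟩ := exists_rel (M := M)
    (P := fun k b => 0 < k ∧ ∀ n, n < y → (Coded d k n ∨ ∃ z, z < b ∧ pair n z ∈ X))
    (.and .auto (.all_lt (.const _) (.or (.coded (.const _) (.var _) (.var _)) .auto)))
  simp only [coded_iff] at hR
  -- All moduli of n < y are at most y d + 1, so k₀ is a multiple of each of them.
  obtain ⟨k₀, hk₀, hk₀'⟩ := exists_common_multiple (M := M) (y * d + 1)
  have hstart : pair k₀ 0 ∈ R := (hR _ _).2 ⟨hk₀, fun n hn => .inl (by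
    have := hk₀' ((n + 1) * d) (Order.lt_add_one_iff.2
      (mul_le_mul_of_nonneg_right (num_add_one_le M hn) zero_le))
    rwa [add_comm] at this)⟩
  obtain ⟨k, b, hkb, hmin⟩ := sigma1_least R ⟨k₀, 0, hstart⟩
  obtain ⟨hk, hkb⟩ := (hR _ _).1 hkb
  refine ⟨b, fun n hn ⟨z, hz⟩ => ?_⟩
  by_contra hcon
  obtain ⟨k', rfl⟩ := (hkb n hn).resolve_right hcon
  have hk' : 0 < k' := pos_of_mul_pos_right hk zero_le
  refine absurd (hmin k' (max b (z + 1)) ((hR _ _).2 ⟨hk', fun i hi => ?_⟩)) (not_le.2 ?_)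
  · rcases eq_or_ne i n with rfl | hne
    · exact .inr ⟨z, lt_max_of_lt_right (lt_add_one z), hz⟩
    · rcases hkb i hi with h | ⟨z', hz', h⟩
      · rw [mul_comm] at h
        exact .inl (dvd_of_modulus_dvd_mul_modulus hd hi hn hne h)
      · exact .inr ⟨z', lt_max_of_lt_left hz', h⟩
  · exact lt_mul_of_one_lt_left hk' (one_lt_modulus hd0 n)

end Coding

/-! ### Arithmetical comprehension from projections -/

section ArithmeticalComprehension

variable {M : L2Structure}

theorem BddDef.fix {m : ℕ} {P : (Fin (m + 1) → M.Num) → Prop} (hP : BddDef P) (e : Fin m → M.Num) :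
    BddDef fun v : Fin 1 → M.Num => P (Fin.snoc (α := fun _ : Fin (m + 1) => M.Num) e (v 0)) := by
  obtain ⟨p, k, a, s, φ, hφ, h⟩ := hP
  refine ⟨p + m, k, Fin.append a e, s, φ, hφ, fun v => ?_⟩
  rw [Fin.append_right_eq_snoc, ← append_right_snoc]
  exact h _

variable [hM : IsRCA M]

/-- `Σ⁰₁` comprehension, for the projections of the sets of `M`. -/
def SigmaComp (M : L2Structure) [IsRCA M] : Prop :=
  ∀ X : M.Sets, ∃ Y : M.Sets, ∀ n, n ∈ Y ↔ ∃ z, pair n z ∈ X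

/-- The projection is itself a set Y, so the unbounded quantifier turns into membership in the new
parameter Y. With several free variables, the last two are merged into one by pairing until one is
left. -/
theorem SigmaComp.bddDef_ex (hS : SigmaComp M) :
    ∀ {m : ℕ} {Q : (Fin m → M.Num) → M.Num → Prop},
      BddDef (fun e : Fin (m + 1) → M.Num => Q (fun i => e i.castSucc) (e (Fin.last m))) →
      BddDef fun e => ∃ x, Q e x
  | 0, Q, _ => (BddDef.prop (∃ x, Q Fin.elim0 x)).congr fun e => by
      rw [Subsingleton.elim e Fin.elim0]
  | 1, Q, hQ => by
    obtain ⟨X, hX⟩ := exists_rel (M := M) (P := fun x y => Q (fun _ => x) y)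
      (hQ.congr fun e => by
        rw [show (fun i : Fin 1 => e i.castSucc) = fun _ => e 0 from
          funext fun i => by rw [Subsingleton.elim i 0]; rfl]
        rfl)
    obtain ⟨Y, hY⟩ := hS X
    refine (BddDef.mem (.var 0) Y).congr fun e => ?_
    rw [hY]
    refine exists_congr fun z => (hX _ _).trans ?_
    rw [show (fun _ => e 0) = e from funext fun i => by rw [Subsingleton.elim i 0]]
  | m + 2, Q, hQ => by
    have hQ' : BddDef fun e : Fin (m + 4) → M.Num =>
        Q (Fin.snoc (α := fun _ : Fin (m + 2) => M.Num) (Fin.snoc (α := fun _ : Fin (m + 1) => M.Num)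
            (fun i : Fin m => e i.castSucc.castSucc.castSucc.castSucc)
            (e (Fin.last (m + 2)).castSucc)) (e (Fin.last (m + 3))))
          (e (Fin.last (m + 1)).castSucc.castSucc) := by
      refine (hQ.subst (Fin.snoc (α := fun _ : Fin (m + 3) => Term (m + 4))
        (Fin.snoc (α := fun _ : Fin (m + 2) => Term (m + 4))
        (Fin.snoc (α := fun _ : Fin (m + 1) => Term (m + 4))
          (fun i : Fin m => .var i.castSucc.castSucc.castSucc.castSucc)
            (.var (Fin.last (m + 2)).castSucc)) (.var (Fin.last (m + 3))))
          (.var (Fin.last (m + 1)).castSucc.castSucc))).congr fun e => ?_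
      simp only [Fin.snoc_last, Fin.snoc_castSucc, Term.eval]
      refine iff_of_eq (congrArg (fun v => Q v _) (funext fun i => ?_))
      refine Fin.lastCases ?_ (fun i => Fin.lastCases ?_ (fun i => ?_) i) i <;> simp [Term.eval]
    have h := SigmaComp.bddDef_ex hS (m := m + 1) (Q := fun e x =>
      ∃ u, u < e (Fin.last m) + 1 ∧ ∃ v, v < e (Fin.last m) + 1 ∧ e (Fin.last m) = pair u v ∧
        Q (Fin.snoc (α := fun _ : Fin (m + 2) => M.Num) (Fin.snoc (α := fun _ : Fin (m + 1) => M.Num)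
            (fun i : Fin m => e i.castSucc) u) v) x)
      (.ex_lt (.add (.var _) (.const 1)) (.ex_lt (.add (.var _) (.const 1))
        (.and (.eq (.var _) (.pair (.var _) (.var _))) hQ')))
    refine (h.subst (Fin.snoc (α := fun _ : Fin (m + 1) => Term (m + 2))
      (fun i : Fin m => .var i.castSucc.castSucc)
      (pairT (.var (Fin.last m).castSucc) (.var (Fin.last (m + 1)))))).congr fun e => ?_
    refine exists_congr fun x => ?_
    have hp : (pairT (.var (Fin.last m).castSucc) (.var (Fin.last (m + 1))) :
        Term (m + 2)).eval M e = pair (e (Fin.last m).castSucc) (e (Fin.last (m + 1))) := rfl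
    simp only [Fin.snoc_last, Fin.snoc_castSucc, hp, Term.eval]
    have he : Fin.snoc (α := fun _ : Fin (m + 2) => M.Num) (Fin.snoc
        (α := fun _ : Fin (m + 1) => M.Num) (fun i : Fin m => e i.castSucc.castSucc)
          (e (Fin.last m).castSucc)) (e (Fin.last (m + 1))) = e := by
      funext i
      refine Fin.lastCases ?_ (fun i => Fin.lastCases ?_ (fun i => ?_) i) i <;> simp
    constructor
    · rintro ⟨u, -, v, -, huv, hq⟩
      obtain ⟨rfl, rfl⟩ := pair_inj huv
      rwa [he] at hq
    · intro hq
      exact ⟨_, Order.lt_add_one_iff.2 (left_le_pair _ _), _,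
        Order.lt_add_one_iff.2 (right_le_pair _ _), rfl, by rwa [he]⟩

theorem SigmaComp.bddDef_all (hS : SigmaComp M) {m : ℕ} {Q : (Fin m → M.Num) → M.Num → Prop}
    (hQ : BddDef fun e : Fin (m + 1) → M.Num => Q (fun i => e i.castSucc) (e (Fin.last m))) :
    BddDef fun e => ∀ x, Q e x :=
  (hS.bddDef_ex (Q := fun e x => ¬ Q e x) hQ.not).not.congr fun e => by push Not; rfl

theorem SigmaComp.bddDef_realize (hS : SigmaComp M) {m k : ℕ} (φ : Formula m k)
    (hφ : φ.IsArithmetical) (s : Fin k → M.Sets) : BddDef fun e => φ.Realize M e s := by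
  induction φ with
  | eq t u => exact .of_isBounded (.eq t u) s
  | lt t u => exact .of_isBounded (.lt t u) s
  | mem t X => exact .of_isBounded (.mem t X) s
  | not φ ih => exact (ih hφ s).not
  | and φ ψ ih₁ ih₂ => exact (ih₁ hφ.1 s).and (ih₂ hφ.2 s)
  | or φ ψ ih₁ ih₂ => exact (ih₁ hφ.1 s).or (ih₂ hφ.2 s)
  | imp φ ψ ih₁ ih₂ => exact (ih₁ hφ.1 s).imp (ih₂ hφ.2 s)
  | all φ ih => exact hS.bddDef_all ((ih hφ s).congr fun e => by rw [← Fin.snoc_init_self e]; simp)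
  | ex φ ih => exact hS.bddDef_ex ((ih hφ s).congr fun e => by rw [← Fin.snoc_init_self e]; simp)
  | allSet φ ih => exact hφ.elim
  | exSet φ ih => exact hφ.elim

theorem isModel_ACA0_iff : M.IsModel ACA0 ↔ SigmaComp M := by
  constructor
  · intro h X
    have := (Formula.satisfies_closure M _).1 (h _ (Or.inr
      ⟨0, 1, .ex (.mem (pairT (.var 0) (.var 1)) 0), trivial, rfl⟩)) Fin.elim0 fun _ => X
    rw [realize_existsSetOf] at this
    exact this
  · rintro hS χ (hχ | ⟨m, k, φ, hφ, rfl⟩)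
    · exact hM.isModel χ hχ
    · refine (Formula.satisfies_closure M _).2 fun e s => (realize_existsSetOf M φ e s).2 ?_
      exact exists_set ((hS.bddDef_realize φ hφ s).fix e)

end ArithmeticalComprehension

section Graphs

variable {M : L2Structure} [hM : IsRCA M]

/-! ## The Rival–Sands theorem in a model of `RCA₀` -/

/-- `X` is infinite. -/
def Unbounded (X : M.Sets) : Prop := ∀ b : M.Num, ∃ y, b < y ∧ y ∈ X

/-- `(V, E)` is a graph. -/
def IsGraph (V E : M.Sets) : Prop :=
  ∀ w ∈ E, ∃ x y : M.Num, x ∈ V ∧ y ∈ V ∧ x < y ∧ w = pair x y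

/-- `y` is a neighbour of `x`. -/
def Nbr (V E : M.Sets) (x y : M.Num) : Prop :=
  y ∈ V ∧ ((x < y ∧ pair x y ∈ E) ∨ (y < x ∧ pair y x ∈ E))

/-- `(V, E)` is locally finite. -/
def IsLocallyFinite (V E : M.Sets) : Prop :=
  ∀ x ∈ V, ∃ b, ∀ y, Nbr V E x y → y < b

/-- `x` has infinitely many neighbours in `H`. -/
def InfNbrs (V E H : M.Sets) (x : M.Num) : Prop := ∀ b, ∃ y, b < y ∧ y ∈ H ∧ Nbr V E x y

/-- `H` is a solution of the Rival–Sands problem for `(V, E)`. -/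
def IsSolution (V E H : M.Sets) : Prop :=
  Unbounded H ∧ (∀ x ∈ H, x ∈ V) ∧ ∀ x ∈ V, InfNbrs V E H x ∨
    ∀ y z, (y ∈ H ∧ Nbr V E x y) ∧ (z ∈ H ∧ Nbr V E x z) → y = z

/-- `H` is a solution of the refined Rival–Sands problem for `(V, E)`. -/
def IsRefinedSolution (V E H : M.Sets) : Prop :=
  IsSolution V E H ∧ ∀ x ∈ H, InfNbrs V E H x ∨ ∀ y, ¬ (y ∈ H ∧ Nbr V E x y)

/-- The semantic predicates follow the formulas connective by connective, so the truth definition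
unfolds to them. -/
theorem satisfies_RSg : M.Satisfies RSg ↔ ∀ V E : M.Sets, IsGraph V E ∧ Unbounded V →
    ∃ H : M.Sets, IsSolution V E H := Iff.rfl

theorem satisfies_RSgr : M.Satisfies RSgr ↔ ∀ V E : M.Sets, IsGraph V E ∧ Unbounded V →
    ∃ H : M.Sets, IsRefinedSolution V E H := Iff.rfl

theorem satisfies_RSgLF : M.Satisfies RSgLF ↔ ∀ V E : M.Sets,
    IsGraph V E ∧ Unbounded V ∧ IsLocallyFinite V E → ∃ H : M.Sets, IsSolution V E H := Iff.rfl

theorem satisfies_RSgrLF : M.Satisfies RSgrLF ↔ ∀ V E : M.Sets,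
    IsGraph V E ∧ Unbounded V ∧ IsLocallyFinite V E → ∃ H : M.Sets, IsRefinedSolution V E H := Iff.rfl

/-- The Rival–Sands theorem for locally finite graphs implies `Σ⁰₁` comprehension. -/
theorem sigmaComp_of_locallyFinite (h : ∀ V E : M.Sets,
    IsGraph V E ∧ Unbounded V ∧ IsLocallyFinite V E → ∃ H : M.Sets, IsSolution V E H) :
    SigmaComp M := by
  intro X
  obtain ⟨V, hV⟩ := exists_set (M := M) (P := fun _ => True) .auto
  obtain ⟨E, hE⟩ := exists_set (M := M)
    (P := fun w => ∃ y, y < w + 1 ∧ ∃ z, z < w + 1 ∧ w = pair y z ∧ y < z ∧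
      ∃ n, n < y ∧ pair n z ∈ X ∧ ∀ z', z' < z → ¬ pair n z' ∈ X) .auto
  have hE' (y z : M.Num) : pair y z ∈ E ↔ y < z ∧
      ∃ n, n < y ∧ pair n z ∈ X ∧ ∀ z', z' < z → ¬ pair n z' ∈ X := by
    rw [hE]
    refine ⟨?_, fun h => ⟨y, Order.lt_add_one_iff.2 (left_le_pair _ _), z,
      Order.lt_add_one_iff.2 (right_le_pair _ _), rfl, h⟩⟩
    rintro ⟨y', -, z', -, he, h⟩
    obtain ⟨rfl, rfl⟩ := pair_inj he
    exact h
  -- A neighbour of y above y is the stage at which some n < y appears, and strong collection bounds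
  -- these stages.
  have hlf : IsLocallyFinite V E := by
    intro y _
    obtain ⟨b, hb⟩ := strong_collection X y
    refine ⟨max b y, fun z ⟨_, hz⟩ => ?_⟩
    rcases hz with ⟨_, hz⟩ | ⟨hz, _⟩
    · obtain ⟨-, n, hn, hnz, hmin⟩ := (hE' _ _).1 hz
      obtain ⟨z', hz', hnz'⟩ := hb n hn ⟨z, hnz⟩
      exact lt_max_of_lt_left (lt_of_le_of_lt (not_lt.1 fun hlt => hmin z' hlt hnz') hz')
    · exact lt_max_of_lt_right hz
  have hgr : IsGraph V E := by
    intro w hw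
    obtain ⟨y, -, z, -, rfl, hyz, -⟩ := (hE w).1 hw
    exact ⟨y, z, (hV _).2 trivial, (hV _).2 trivial, hyz, rfl⟩
  obtain ⟨H, hinf, -, hH⟩ := h V E ⟨hgr, fun b => ⟨b + 1, lt_add_one b, (hV _).2 trivial⟩, hlf⟩
  have hone (z y y' : M.Num) (hy : y ∈ H) (hy' : y' ∈ H) (hyz : pair y z ∈ E)
      (hyz' : pair y' z ∈ E) : y = y' := by
    rcases hH z ((hV _).2 trivial) with hi | h1
    · obtain ⟨b, hb⟩ := hlf z ((hV _).2 trivial)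
      obtain ⟨u, hu, -, hzu⟩ := hi b
      exact absurd (hb u hzu) (not_lt.2 hu.le)
    · exact h1 y y' ⟨⟨hy, (hV _).2 trivial, .inr ⟨((hE' _ _).1 hyz).1, hyz⟩⟩,
        ⟨hy', (hV _).2 trivial, .inr ⟨((hE' _ _).1 hyz').1, hyz'⟩⟩⟩
  -- The `Π⁰₁` form: whenever y' in H has another element of H strictly between n and itself, n has
  -- a witness up to y'.
  refine exists_set_of_delta1 (M := M) (P := fun n z => pair n z ∈ X)
    (Q := fun n y' => y' ∈ H → (∃ y, y < y' ∧ n < y ∧ y ∈ H) → ∃ z, z < y' + 1 ∧ pair n z ∈ X)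
    .auto .auto fun n => ⟨?_, fun hn => ?_⟩
  · rintro ⟨z₀, hz₀⟩ y' hy' ⟨y, hyy', hny, hy⟩
    -- The second coordinate is a dummy; only the least witness z is wanted.
    obtain ⟨R, hR⟩ := exists_rel (M := M) (P := fun z _ => pair n z ∈ X) .auto
    obtain ⟨z, z₁, hz, hmin⟩ := sigma1_least R ⟨z₀, 0, (hR _ _).2 hz₀⟩
    have hz := (hR _ _).1 hz
    refine ⟨z, Order.lt_add_one_iff.2 (not_lt.1 fun hlt => ?_), hz⟩
    have hmin' (z') (hz' : z' < z) : ¬ pair n z' ∈ X := fun hcon =>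
      absurd (hmin z' 0 ((hR _ _).2 hcon)) (not_le.2 hz')
    exact hyy'.ne (hone z y y' hy hy' ((hE' _ _).2 ⟨hyy'.trans hlt, n, hny, hz, hmin'⟩)
      ((hE' _ _).2 ⟨hlt, n, hny.trans hyy', hz, hmin'⟩))
  · obtain ⟨y, hny, hy⟩ := hinf n
    obtain ⟨y', hyy', hy'⟩ := hinf y
    obtain ⟨z, -, hz⟩ := hn y' hy' ⟨y, hyy', hny, hy⟩
    exact ⟨z, hz⟩

end Graphs

/-! ### From arithmetical comprehension to the refined theorem -/

section Forward

variable {M : L2Structure} [hM : IsRCA M]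

/-- Replaces a bounded set by the numbers d, c, b, over which number quantifiers can range. -/
theorem exists_code_of_bounded (X : M.Sets) (b : M.Num) (hb : ∀ w ∈ X, w < b) :
    ∃ d c : M.Num, ∀ w, (w < b ∧ Coded d c w) ↔ w ∈ X := by
  obtain ⟨d, c, h⟩ := exists_code X b
  exact ⟨d, c, fun w => ⟨fun hw => (h w hw.1).1 hw.2, fun hw => ⟨hb w hw, (h w (hb w hw)).2 hw⟩⟩⟩

theorem eq_zero_or_exists_add_one (n : M.Num) : n = 0 ∨ ∃ m, n = m + 1 := by
  rcases eq_or_ne n 0 with h | h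
  · exact .inl h
  · obtain ⟨m, rfl⟩ := exists_add_of_le (num_one_le M (pos_iff_ne_zero.2 h))
    exact .inr ⟨m, add_comm _ _⟩

theorem Nbr.symm {V E : M.Sets} {x y : M.Num} (h : Nbr V E x y) (hx : x ∈ V) : Nbr V E y x :=
  ⟨hx, h.2.symm⟩

theorem BddDef.nbr {V E : M.Sets} {m : ℕ} {f g : (Fin m → M.Num) → M.Num} (hf : TermDef f)
    (hg : TermDef g) : BddDef fun e => Nbr V E (f e) (g e) :=
  (BddDef.mem hg V).and (((BddDef.lt hf hg).and (.mem (hf.pair hg) E)).or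
    ((BddDef.lt hg hf).and (.mem (hg.pair hf) E)))

/-- Collection for relations which are upward closed in the second argument. -/
theorem exists_uniform_bound (D : M.Sets) (hD : ∀ x : M.Num, ∃ g, pair x g ∈ D)
    (hmono : ∀ x g g', g ≤ g' → pair x g ∈ D → pair x g' ∈ D) (a : M.Num) :
    ∃ g, ∀ x, x < a → pair x g ∈ D := by
  obtain ⟨g, hg⟩ := strong_collection D a
  refine ⟨g, fun x hx => ?_⟩
  obtain ⟨g', hg', h⟩ := hg x hx (hD x)
  exact hmono x g' g hg'.le h

variable [hS : Fact (SigmaComp M)]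

/-! ### Arithmetical recursion -/

/-- From here on `BddDef` is closed under all number quantifiers, so `bdd_induction` and
`exists_set` serve for arithmetical relations. -/
theorem BddDef.ex {m : ℕ} {Q : (Fin m → M.Num) → M.Num → Prop}
    (hQ : BddDef fun e : Fin (m + 1) → M.Num => Q (fun i => e i.castSucc) (e (Fin.last m))) :
    BddDef fun e => ∃ x, Q e x := hS.out.bddDef_ex hQ

theorem BddDef.all {m : ℕ} {Q : (Fin m → M.Num) → M.Num → Prop}
    (hQ : BddDef fun e : Fin (m + 1) → M.Num => Q (fun i => e i.castSucc) (e (Fin.last m))) :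
    BddDef fun e => ∀ x, Q e x := hS.out.bddDef_all hQ

/-- Definability of an arithmetical relation, from its syntactic form. -/
theorem BddDef.autoArith {M : L2Structure} {m : ℕ} {P : (Fin m → M.Num) → Prop}
    (h : BddDef P := by
      apply_rules [BddDef.coded, BddDef.mem, BddDef.eq, BddDef.lt, BddDef.le, BddDef.and,
        BddDef.or, BddDef.iff, BddDef.ex, BddDef.all, BddDef.not, BddDef.imp, TermDef.pair,
        TermDef.add, TermDef.mul, TermDef.var, TermDef.const, BddDef.prop]) : BddDef P := h

/-- Always taking the least successor makes the sequence unique. Its graph F is defined through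
coded finite histories, and induction shows that F is total and single-valued. -/
theorem exists_recursion (R : M.Sets) (hR : ∀ n a : M.Num, ∃ b, pair (pair n a) b ∈ R)
    (a₀ : M.Num) : ∃ (f : M.Num → M.Num) (F : M.Sets), (∀ n a, pair n a ∈ F ↔ a = f n) ∧
      f 0 = a₀ ∧ ∀ n, pair (pair n (f n)) (f (n + 1)) ∈ R := by
  have hstep (n a : M.Num) : ∃ b, pair (pair n a) b ∈ R ∧
      ∀ b', b' < b → ¬ pair (pair n a) b' ∈ R := by
    obtain ⟨T, hT⟩ := exists_rel (M := M) (P := fun b _ => pair (pair n a) b ∈ R) .auto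
    obtain ⟨b, z, hb, hmin⟩ := sigma1_least T ((hR n a).imp fun b hb => ⟨0, (hT _ _).2 hb⟩)
    exact ⟨b, (hT _ _).1 hb, fun b' hlt h =>
      absurd (hmin b' 0 ((hT _ _).2 h)) (not_le.2 hlt)⟩
  have hfun (n a b b' : M.Num)
      (h : pair (pair n a) b ∈ R ∧ ∀ x, x < b → ¬ pair (pair n a) x ∈ R)
      (h' : pair (pair n a) b' ∈ R ∧ ∀ x, x < b' → ¬ pair (pair n a) x ∈ R) : b = b' :=
    le_antisymm (not_lt.1 fun hlt => h.2 _ hlt h'.1) (not_lt.1 fun hlt => h'.2 _ hlt h.1)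
  -- The numbers d, c, b code a history: each of its pairs is the initial one or comes from a pair
  -- of the same history by a least step.
  obtain ⟨F, hF⟩ := exists_rel (M := M)
    (P := fun n x => ∃ d, ∃ c, ∃ b, (pair n x < b ∧ Coded d c (pair n x)) ∧
      ∀ i, ∀ y, (pair i y < b ∧ Coded d c (pair i y)) → ((i = 0 ∧ y = a₀) ∨
        ∃ j, ∃ z, i = j + 1 ∧ (pair j z < b ∧ Coded d c (pair j z)) ∧
          pair (pair j z) y ∈ R ∧ ∀ x, x < y → ¬ pair (pair j z) x ∈ R))
    (.ex (.ex (.ex (.and .autoArith (.all (.all (.imp .autoArith (.or .autoArith .autoArith))))))))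
  have hF0 (x : M.Num) : pair 0 x ∈ F ↔ x = a₀ := by
    rw [hF]
    constructor
    · rintro ⟨d, c, b, hx, h⟩
      rcases h 0 x hx with ⟨-, h⟩ | ⟨j, z, hj, -⟩
      · exact h
      · exact absurd hj (by positivity : (0 : M.Num) < j + 1).ne
    · rintro rfl
      obtain ⟨X, hX⟩ := exists_set (M := M) (P := fun w => w = pair 0 x) .auto
      obtain ⟨d, c, hdc⟩ := exists_code_of_bounded X (pair 0 x + 1) fun w hw => by
        rw [(hX w).1 hw]; exact lt_add_one _
      simp only [hX] at hdc
      refine ⟨d, c, pair 0 x + 1, (hdc _).2 rfl, fun i y hy => .inl ?_⟩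
      exact pair_inj ((hdc _).1 hy)
  have hFs (n x y : M.Num) (hx : pair n x ∈ F)
      (h : pair (pair n x) y ∈ R ∧ ∀ z, z < y → ¬ pair (pair n x) z ∈ R) :
      pair (n + 1) y ∈ F := by
    rw [hF] at hx ⊢
    obtain ⟨d, c, b, hx, hj⟩ := hx
    obtain ⟨X, hX⟩ := exists_set (M := M)
      (P := fun w => (w < b ∧ Coded d c w) ∨ w = pair (n + 1) y) .autoArith
    obtain ⟨d', c', hdc⟩ := exists_code_of_bounded X (max b (pair (n + 1) y + 1)) fun w hw => by
      rcases (hX w).1 hw with hw | rfl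
      · exact lt_max_of_lt_left hw.1
      · exact lt_max_of_lt_right (lt_add_one _)
    simp only [hX] at hdc
    refine ⟨d', c', _, (hdc _).2 (.inr rfl), fun i u hu => ?_⟩
    simp only [hdc] at hu ⊢
    rcases hu with hu | hu
    · rcases hj i u hu with hi | ⟨j, z, hi, hz, hzu⟩
      · exact .inl hi
      · exact .inr ⟨j, z, hi, .inl hz, hzu⟩
    · obtain ⟨rfl, rfl⟩ := pair_inj hu
      exact .inr ⟨n, x, rfl, .inl hx, h⟩
  have hFs' (n y : M.Num) (hy : pair (n + 1) y ∈ F) : ∃ x, pair n x ∈ F ∧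
      (pair (pair n x) y ∈ R ∧ ∀ z, z < y → ¬ pair (pair n x) z ∈ R) := by
    obtain ⟨d, c, b, hy, hj⟩ := (hF _ _).1 hy
    rcases hj _ _ hy with ⟨h, -⟩ | ⟨j, z, hi, hz, hzy⟩
    · exact absurd h (by positivity : (0 : M.Num) < n + 1).ne'
    · obtain rfl := add_right_cancel hi
      exact ⟨z, (hF _ _).2 ⟨d, c, b, hz, hj⟩, hzy⟩
  have hex (n : M.Num) : ∃ x, pair n x ∈ F := by
    refine bdd_induction (M := M) (P := fun n => ∃ x, pair n x ∈ F) .autoArith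
      ⟨a₀, (hF0 _).2 rfl⟩ ?_ n
    rintro n ⟨x, hx⟩
    exact (hstep n x).imp fun y hy => hFs n x y hx hy
  have huniq (n : M.Num) : ∀ x, ∀ y, pair n x ∈ F → pair n y ∈ F → x = y := by
    refine bdd_induction (M := M) (P := fun n => ∀ x, ∀ y, pair n x ∈ F → pair n y ∈ F → x = y)
      .autoArith ?_ ?_ n
    · intro x y hx hy
      rw [(hF0 x).1 hx, (hF0 y).1 hy]
    · intro n ih x y hx hy
      obtain ⟨u, hu, hux⟩ := hFs' n x hx
      obtain ⟨v, hv, hvy⟩ := hFs' n y hy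
      obtain rfl := ih u v hu hv
      exact hfun n u x y hux hvy
  -- The function f is chosen outside the model; F is its graph inside, and inductions about f must
  -- be phrased with F.
  choose f hf using hex
  refine ⟨f, F, fun n a => ⟨fun h => huniq n a (f n) h (hf n), ?_⟩, (hF0 _).1 (hf 0), fun n => ?_⟩
  · rintro rfl
    exact hf n
  · obtain ⟨x, hx, hxy⟩ := hFs' n _ (hf (n + 1))
    obtain rfl := huniq n x (f n) hx (hf n)
    exact hxy.1

/-! ### Arithmetical comprehension implies the refined Rival–Sands theorem -/

/-- The case of finitely many vertices of finite degree. -/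
theorem exists_refined_of_bounded {V E F₀ : M.Sets} (hV : Unbounded V)
    (hF₀ : ∀ x, x ∈ F₀ ↔ x ∈ V ∧ ∃ b, ∀ y, Nbr V E x y → y < b) (hb : ¬ Unbounded F₀) :
    ∃ H : M.Sets, IsRefinedSolution V E H := by
  unfold Unbounded at hb
  push Not at hb
  obtain ⟨b₀, hb₀⟩ := hb
  obtain ⟨D, hD⟩ := exists_rel (M := M) (P := fun x g => x ∈ F₀ → ∀ y, Nbr V E x y → y < g)
    (.imp .auto (.all (.imp (.nbr (.var _) (.var _)) .auto)))
  obtain ⟨g, hg⟩ := exists_uniform_bound D (fun x => by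
    by_cases hx : x ∈ F₀
    · obtain ⟨b, hb⟩ := ((hF₀ x).1 hx).2
      exact ⟨b, (hD _ _).2 fun _ => hb⟩
    · exact ⟨0, (hD _ _).2 fun h => absurd h hx⟩) (fun x g g' hle h => (hD _ _).2 fun hx y hy =>
        ((hD _ _).1 h hx y hy).trans_le hle) (b₀ + 1)
  -- All vertices of finite degree are at most b₀, and g bounds their neighbours. They have no
  -- neighbour in H, while every other vertex keeps infinitely many.
  obtain ⟨H, hH⟩ := exists_set (M := M) (P := fun x => x ∈ V ∧ g ≤ x) .auto
  have key (x) (hx : x ∈ V) : InfNbrs V E H x ∨ ∀ y, ¬ (y ∈ H ∧ Nbr V E x y) := by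
    by_cases hxF : x ∈ F₀
    · have hxb : x < b₀ + 1 := Order.lt_add_one_iff.2 (not_lt.1 fun h => hb₀ x h hxF)
      refine .inr fun y hy => ?_
      exact absurd ((hD _ _).1 (hg x hxb) hxF y hy.2) (not_lt.2 ((hH y).1 hy.1).2)
    · refine .inl fun b => ?_
      by_contra hcon
      refine hxF ((hF₀ x).2 ⟨hx, max g (b + 1), fun y hy => ?_⟩)
      by_contra hlt
      rw [not_lt, max_le_iff] at hlt
      exact hcon ⟨y, Order.add_one_le_iff.1 hlt.2, (hH y).2 ⟨hy.1, hlt.1⟩, hy⟩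
  refine ⟨H, ⟨fun b => ?_, fun x hx => ((hH x).1 hx).1, fun x hx => ?_⟩,
    fun x hx => key x ((hH x).1 hx).1⟩
  · obtain ⟨y, hy, hyV⟩ := hV (max b g)
    exact ⟨y, (le_max_left _ _).trans_lt hy, (hH y).2 ⟨hyV, ((le_max_right _ _).trans_lt hy).le⟩⟩
  · exact (key x hx).imp id fun h y z hyz => absurd hyz.1 (h y)

/-- The case of infinitely many vertices of finite degree. -/
theorem exists_refined_of_unbounded {V E F₀ : M.Sets}
    (hF₀ : ∀ x, x ∈ F₀ ↔ x ∈ V ∧ ∃ b, ∀ y, Nbr V E x y → y < b) (hu : Unbounded F₀) :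
    ∃ H : M.Sets, IsRefinedSolution V E H := by
  obtain ⟨B, hB⟩ := exists_set (M := M) (P := fun x => ∀ b, ∃ y, b < y ∧ y ∈ F₀ ∧ Nbr V E x y)
    (.all (.ex (.and .auto (.and .auto (.nbr (.var _) (.var _))))))
  -- Here g bounds two sets when they are required to be finite: all neighbours of x if x is in F₀,
  -- and the neighbours of x in F₀ if x is outside B.
  obtain ⟨D, hD⟩ := exists_rel (M := M)
    (P := fun x g => (x ∈ F₀ → ∀ y, Nbr V E x y → y < g) ∧
      (¬ x ∈ B → ∀ y, y ∈ F₀ → Nbr V E x y → y < g))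
    (.and (.imp .auto (.all (.imp (.nbr (.var _) (.var _)) .auto)))
      (.imp .auto (.all (.imp .auto (.imp (.nbr (.var _) (.var _)) .auto)))))
  have hbound := exists_uniform_bound D (fun x => by
    have h₁ : ∃ g, x ∈ F₀ → ∀ y, Nbr V E x y → y < g := by
      by_cases hx : x ∈ F₀
      · exact ((hF₀ x).1 hx).2.imp fun b hb _ => hb
      · exact ⟨0, fun h => absurd h hx⟩
    have h₂ : ∃ g, ¬ x ∈ B → ∀ y, y ∈ F₀ → Nbr V E x y → y < g := by
      by_cases hx : x ∈ B
      · exact ⟨0, fun h => absurd hx h⟩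
      · rw [hB] at hx
        push Not at hx
        obtain ⟨b, hb⟩ := hx
        exact ⟨b + 1, fun _ y hy hxy => Order.lt_add_one_iff.2 (not_lt.1 fun h => hb y h hy hxy)⟩
    obtain ⟨g₁, h₁⟩ := h₁
    obtain ⟨g₂, h₂⟩ := h₂
    exact ⟨max g₁ g₂, (hD _ _).2 ⟨fun hx y hy => lt_max_of_lt_left (h₁ hx y hy),
      fun hx y hy hxy => lt_max_of_lt_right (h₂ hx y hy hxy)⟩⟩) (fun x g g' hle h => by
        have h := (hD _ _).1 h
        exact (hD _ _).2 ⟨fun hx y hy => (h.1 hx y hy).trans_le hle,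
          fun hx y hy hxy => (h.2 hx y hy hxy).trans_le hle⟩)
  -- The next term h is at least g and g': neighbours of terms up to a lie below g, and a number
  -- below g outside B has its neighbours in F₀ below g'. Step `pair x y` serves x if x is in B; the
  -- free coordinate y makes this happen infinitely often.
  obtain ⟨R, hR⟩ := exists_rel (M := M) (P := fun w h => ∃ n, ∃ a, w = pair n a ∧ a < h ∧ h ∈ F₀ ∧
      (∃ g, ∃ g', g ≤ h ∧ g' ≤ h ∧ (∀ x, x < a + 1 → pair x g ∈ D) ∧
        ∀ x, x < g → pair x g' ∈ D) ∧
      ∀ x, ∀ y, n = pair x y → x ∈ B → Nbr V E x h)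
    (.ex (.ex (.and .auto (.and .auto (.and .auto (.and .autoArith
      (.all (.all (.imp .auto (.imp .auto (.nbr (.var _) (.var _))))))))))))
  have hR' (n a h : M.Num) : pair (pair n a) h ∈ R ↔ a < h ∧ h ∈ F₀ ∧
      (∃ g, ∃ g', g ≤ h ∧ g' ≤ h ∧ (∀ x, x < a + 1 → pair x g ∈ D) ∧
        ∀ x, x < g → pair x g' ∈ D) ∧
      ∀ x, ∀ y, n = pair x y → x ∈ B → Nbr V E x h := by
    rw [hR]
    refine ⟨?_, fun h => ⟨n, a, rfl, h⟩⟩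
    rintro ⟨n', a', he, h⟩
    obtain ⟨rfl, rfl⟩ := pair_inj he
    exact h
  obtain ⟨a₀, -, ha₀⟩ := hu 0
  obtain ⟨f, F, hF, hf0, hfs⟩ := exists_recursion R (fun n a => by
    obtain ⟨g, hg⟩ := hbound (a + 1)
    obtain ⟨g', hg'⟩ := hbound g
    have hh : ∃ h, max a (max g g') < h ∧ h ∈ F₀ ∧
        ∀ x, ∀ y, n = pair x y → x ∈ B → Nbr V E x h := by
      by_cases hn : ∃ x y, n = pair x y ∧ x ∈ B
      · obtain ⟨x, y, rfl, hx⟩ := hn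
        obtain ⟨h, hlt, hhF, hxh⟩ := (hB x).1 hx (max a (max g g'))
        refine ⟨h, hlt, hhF, fun x' y' he _ => ?_⟩
        obtain ⟨rfl, rfl⟩ := pair_inj he
        exact hxh
      · obtain ⟨h, hlt, hhF⟩ := hu (max a (max g g'))
        exact ⟨h, hlt, hhF, fun x y he hx => absurd ⟨x, y, he, hx⟩ hn⟩
    obtain ⟨h, hlt, hhF, hn⟩ := hh
    simp only [max_lt_iff] at hlt
    exact ⟨h, (hR' _ _ _).2 ⟨hlt.1, hhF, ⟨g, g', hlt.2.1.le, hlt.2.2.le, hg, hg'⟩, hn⟩⟩) a₀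
  simp only [hR'] at hfs
  have hfF (n : M.Num) : f n ∈ F₀ := by
    rcases eq_zero_or_exists_add_one n with rfl | ⟨m, rfl⟩
    · rwa [hf0]
    · exact (hfs m).2.1
  have hfV (n : M.Num) : f n ∈ V := ((hF₀ _).1 (hfF n)).1
  have hge (n : M.Num) : n ≤ f n := by
    have := bdd_induction (M := M) (P := fun n => ∀ a, pair n a ∈ F → n ≤ a) .autoArith
      (fun a _ => zero_le) (fun n ih a ha => by
        rw [(hF _ _).1 ha]
        exact num_add_one_le M ((ih _ ((hF _ _).2 rfl)).trans_lt (hfs n).1)) n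
    exact this _ ((hF _ _).2 rfl)
  have hmono {i j : M.Num} (hij : i ≤ j) : f i ≤ f j := by
    have := bdd_induction (M := M) (P := fun j => ∀ a, pair j a ∈ F → i ≤ j → f i ≤ a) .autoArith
      (fun a ha hi => by rw [(hF _ _).1 ha, le_antisymm hi zero_le]) (fun n ih a ha hi => by
        rw [(hF _ _).1 ha]
        rcases hi.lt_or_eq with hi | rfl
        · exact (ih _ ((hF _ _).2 rfl) (Order.lt_add_one_iff.1 hi)).trans (hfs n).1.le
        · exact le_rfl) j
    exact this _ ((hF _ _).2 rfl) hij
  have hsep {i j : M.Num} (hij : i < j) : ¬ Nbr V E (f i) (f j) ∧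
      ∀ x ∈ V, x ∉ B → Nbr V E x (f i) → ¬ Nbr V E x (f j) := by
    obtain rfl | ⟨m, rfl⟩ := eq_zero_or_exists_add_one j
    · exact absurd hij not_lt_zero
    obtain ⟨-, hF', ⟨g, g', hg, hg', hDg, hDg'⟩, -⟩ := hfs m
    have hN : ∀ y, Nbr V E (f i) y → y < g := ((hD _ _).1 (hDg (f i)
      (Order.lt_add_one_iff.2 (hmono (Order.lt_add_one_iff.1 hij))))).1 (hfF i)
    -- A common neighbour x is below g as a neighbour of the earlier term; being outside B, it has
    -- no neighbour in F₀ from g' on, yet the later term is such a neighbour.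
    refine ⟨fun h => absurd (hN _ h) (not_lt.2 hg), fun x hx hxB hxi hxj => ?_⟩
    have := ((hD _ _).1 (hDg' x (hN x (hxi.symm hx)))).2 hxB _ hF' hxj
    exact absurd this (not_lt.2 hg')
  obtain ⟨H, hH⟩ := exists_set (M := M) (P := fun h => ∃ n, pair n h ∈ F) .autoArith
  simp only [hF] at hH
  refine ⟨H, ⟨fun b => ⟨f (b + 1), (lt_add_one b).trans_le (hge _), (hH _).2 ⟨_, rfl⟩⟩, ?_, ?_⟩, ?_⟩
  · intro x hx
    obtain ⟨n, rfl⟩ := (hH _).1 hx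
    exact hfV n
  · intro x hx
    by_cases hxB : x ∈ B
    · refine .inl fun b => ⟨f (pair x b + 1), ?_, (hH _).2 ⟨_, rfl⟩,
        (hfs (pair x b)).2.2.2 x b rfl hxB⟩
      exact ((right_le_pair x b).trans (hge _)).trans_lt (hfs _).1
    · refine .inr ?_
      rintro y z ⟨⟨hy, hxy⟩, hz, hxz⟩
      obtain ⟨i, rfl⟩ := (hH _).1 hy
      obtain ⟨j, rfl⟩ := (hH _).1 hz
      rcases lt_trichotomy i j with h | rfl | h
      · exact absurd hxz ((hsep h).2 x hx hxB hxy)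
      · rfl
      · exact absurd hxy ((hsep h).2 x hx hxB hxz)
  · intro x hx
    obtain ⟨i, rfl⟩ := (hH _).1 hx
    refine .inr ?_
    rintro y ⟨hy, hxy⟩
    obtain ⟨j, rfl⟩ := (hH _).1 hy
    rcases lt_trichotomy i j with h | rfl | h
    · exact (hsep h).1 hxy
    · rcases hxy.2 with h | h <;> exact lt_irrefl _ h.1
    · exact (hsep h).1 (hxy.symm (hfV i))

theorem exists_refined (V E : M.Sets) (hV : Unbounded V) :
    ∃ H : M.Sets, IsRefinedSolution V E H := by
  obtain ⟨F₀, hF₀⟩ := exists_set (M := M)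
    (P := fun x => x ∈ V ∧ ∃ b, ∀ y, Nbr V E x y → y < b)
    (.and .auto (.ex (.all (.imp (.nbr (.var _) (.var _)) .auto))))
  by_cases hu : Unbounded F₀
  · exact exists_refined_of_unbounded hF₀ hu
  · exact exists_refined_of_bounded hV hF₀ hu

end Forward
end SOA

theorem mainTheorem1 (M : SOA.L2Structure) (hM : M.IsModel SOA.RCA0) :
    List.TFAE [M.IsModel SOA.ACA0, M.Satisfies SOA.RSg, M.Satisfies SOA.RSgr,
      M.Satisfies SOA.RSgLF, M.Satisfies SOA.RSgrLF] := by
  have : SOA.IsRCA M := ⟨hM⟩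
  rw [SOA.satisfies_RSg, SOA.satisfies_RSgr, SOA.satisfies_RSgLF, SOA.satisfies_RSgrLF,
    SOA.isModel_ACA0_iff]
  tfae_have 1 → 3 := fun h V E hVE => by
    have : Fact (SOA.SigmaComp M) := ⟨h⟩
    exact SOA.exists_refined V E hVE.2
  tfae_have 3 → 2 := fun h V E hVE => (h V E hVE).imp fun _ hH => hH.1
  tfae_have 3 → 5 := fun h V E hVE => h V E ⟨hVE.1, hVE.2.1⟩
  tfae_have 2 → 4 := fun h V E hVE => h V E ⟨hVE.1, hVE.2.1⟩
  tfae_have 5 → 4 := fun h V E hVE => (h V E hVE).imp fun _ hH => hH.1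
  tfae_have 4 → 1 := SOA.sigmaComp_of_locallyFinite
  tfae_finish
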